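/- Let $N\geq 3$ be an integer, let $H_1=\mathbb{C}^N$ with canonical basis $(e_a)_a$, and let $t=\sum_a e_a\otimes e_a\in H_1\otimes H_1$. For $n\geq 0$ let $H_n\subset H_1^{\otimes n}$ be the range of the $n$-th Jones–Wenzl projection, that is, the subspace of all vectors $\zeta\in H_1^{\otimes n}$ such that $(\mathrm{id}_i\otimes t^*\otimes\mathrm{id}_{n-i-2})(\zeta)=0$ for all $0\leq i\leq n-2$; put $d_n=\dim H_n$. Regard $X\in B(H_n)$ as an operator on $H_1^{\otimes n}$, extended by $0$ on $H_n^\perp$, and for $n\geq 1$ define, with $\mathrm{Tr}_1$ the trace of $B(H_1)$, $$B(H_n)^{\circ\circ}=\{X\in B(H_n)\mid (\mathrm{Tr}_1\otimes\mathrm{id})(X)=0=(\mathrm{id}\otimes\mathrm{Tr}_1)(X)\}.$$ Let $\mathbb{F}O_N$ be the orthogonal free quantum group: its coefficient algebra is the universal unital $*$-algebra generated by self-adjoint elements $u_{ij}$, $1\leq i,j\leq N$, such that the matrix $u=(u_{ij})$ is unitary, with coproduct $\Delta(u_{ij})=\sum_k u_{ik}\otimes u_{kj}$. Let $h$ be its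 Haar state (the unique bi-invariant state), and let $H=\ell^2(\mathbb{F}O_N)$ be the GNS space of $h$, with scalar product $(x\mid y)=h(x^*y)$. Let $u_n$ be the restriction of $u^{\otimes n}$ to $H_n$, and for $X\in B(H_n)$ let $u_n(X)=(\mathrm{id}\otimes\mathrm{Tr})(u_n(1\otimes X))\in H$. Let $p_n$ be the orthogonal projection of $H$ onto $u_n(B(H_n))$, and let $H^{\circ\circ}\subset H$ be the closed linear span of the subspaces $u_n(B(H_n)^{\circ\circ})$, $n\geq 1$. Then for every $n\geq 2$ $$\dim B(H_n)^{\circ\circ}=\dim p_nH^{\circ\circ}=d_{2n}-d_{2n-2},$$ and $\dim B(H_1)^{\circ\circ}=\dim p_1H^{\circ\circ}=d_2$. -/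

import Mathlib

noncomputable section

namespace FON

open scoped TensorProduct ComplexOrder

/-! ### The tensor powers of `H_1 = ℂ^N` and the Jones-Wenzl subspaces -/

/-- The Hilbert space `H_1^{⊗n}` for `H_1 = ℂ^N`, in coordinates with respect to the orthonormal
basis `e_{i_1} ⊗ ⋯ ⊗ e_{i_n}`. -/
abbrev TPow (N n : ℕ) : Type := EuclideanSpace ℂ (Fin n → Fin N)

/-- The contraction `id_i ⊗ t^* ⊗ id_{m-i} : H_1^{⊗(m+2)} → H_1^{⊗m}`, where
`t = ∑_a e_a ⊗ e_a`: two copies of the letter `a` are inserted at the places `i` and `i + 1`. -/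
def contract (N m : ℕ) (i : Fin (m + 1)) : TPow N (m + 2) →ₗ[ℂ] TPow N m where
  toFun ζ := WithLp.toLp 2 fun x : Fin m → Fin N =>
    ∑ a : Fin N, ζ (i.castSucc.insertNth a (i.insertNth a x : Fin (m + 1) → Fin N))
  map_add' ζ ξ := by
    ext x
    simp [Finset.sum_add_distrib]
  map_smul' c ζ := by
    ext x
    simp [Finset.mul_sum]

/-- The space `H_n ⊆ H_1^{⊗n}` (the range of the `n`-th Jones-Wenzl projection): the vectors
killed by all contractions `id_i ⊗ t^* ⊗ id_{n-i-2}`, `0 ≤ i ≤ n - 2`. -/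
def HSpace (N : ℕ) : (n : ℕ) → Submodule ℂ (TPow N n)
  | 0 => ⊤
  | 1 => ⊤
  | (m + 2) => ⨅ i : Fin (m + 1), LinearMap.ker (contract N m i)

/-- `d_n = dim H_n`. -/
def d (N n : ℕ) : ℕ := Module.finrank ℂ (HSpace N n)

/-- `B(H_n)`. -/
abbrev BH (N n : ℕ) : Type := Module.End ℂ (HSpace N n)

/-- Operators on `H_1^{⊗n}`, as matrices in the basis `e_{i_1} ⊗ ⋯ ⊗ e_{i_n}`. -/
abbrev TMat (N n : ℕ) : Type := Matrix (Fin n → Fin N) (Fin n → Fin N) ℂ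

/-- The embedding `B(H_n) → B(H_1^{⊗n})`, which sends `X` to `X P_n`, where `P_n` is the orthogonal
projection onto `H_n` (so that `X` is extended by `0` on the orthogonal complement of `H_n`). -/
def extend (N n : ℕ) : BH N n →ₗ[ℂ] TMat N n where
  toFun X := Matrix.of fun x y =>
    (X ((HSpace N n).orthogonalProjectionOnto (EuclideanSpace.single y 1)) : TPow N n) x
  map_add' X Y := by
    ext x y
    simp
  map_smul' c X := by
    ext x y
    simp

/-- The partial trace `Tr_1 ⊗ id : B(H_1 ⊗ H_1^{⊗m}) → B(H_1^{⊗m})`. -/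
def leftTrace (N m : ℕ) : TMat N (m + 1) →ₗ[ℂ] TMat N m where
  toFun X := Matrix.of fun x y => ∑ a : Fin N, X (Fin.cons a x) (Fin.cons a y)
  map_add' X Y := by
    ext x y
    simp [Finset.sum_add_distrib]
  map_smul' c X := by
    ext x y
    simp [Finset.mul_sum]

/-- The partial trace `id ⊗ Tr_1 : B(H_1^{⊗m} ⊗ H_1) → B(H_1^{⊗m})`. -/
def rightTrace (N m : ℕ) : TMat N (m + 1) →ₗ[ℂ] TMat N m where
  toFun X := Matrix.of fun x y =>
    ∑ a : Fin N, X (Fin.snoc x a : Fin (m + 1) → Fin N) (Fin.snoc y a : Fin (m + 1) → Fin N)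
  map_add' X Y := by
    ext x y
    simp [Finset.sum_add_distrib]
  map_smul' c X := by
    ext x y
    simp [Finset.mul_sum]

/-- `B(H_n)^{∘∘} = {X ∈ B(H_n) | (Tr_1 ⊗ id)(X) = 0 = (id ⊗ Tr_1)(X)}` for `n ≥ 1`.
This notion is not used for `n = 0`. -/
def BCirc (N : ℕ) : (n : ℕ) → Submodule ℂ (BH N n)
  | 0 => ⊥
  | (m + 1) => LinearMap.ker (leftTrace N m ∘ₗ extend N (m + 1)) ⊓
      LinearMap.ker (rightTrace N m ∘ₗ extend N (m + 1))

/-! ### The orthogonal free quantum group -/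

/-- The relations `u u^* = 1 = u^* u` between self-adjoint generators `u_{ij}`. -/
inductive Rel (N : ℕ) :
    FreeAlgebra ℂ (Fin N × Fin N) → FreeAlgebra ℂ (Fin N × Fin N) → Prop
  | row (i j : Fin N) :
      Rel N (∑ k, FreeAlgebra.ι ℂ (i, k) * FreeAlgebra.ι ℂ (j, k)) (if i = j then 1 else 0)
  | col (i j : Fin N) :
      Rel N (∑ k, FreeAlgebra.ι ℂ (k, i) * FreeAlgebra.ι ℂ (k, j)) (if i = j then 1 else 0)

/-- The universal unital `*`-algebra generated by self-adjoint elements `u_{ij}`,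
`1 ≤ i, j ≤ N`, such that the matrix `u = (u_{ij})` is unitary. It is the canonical dense
`*`-subalgebra of `C^*(𝔽O_N)`, spanned by the coefficients of the corepresentations. -/
def Pol (N : ℕ) : Type := RingQuot (Rel N)

instance (N : ℕ) : Ring (Pol N) := inferInstanceAs (Ring (RingQuot (Rel N)))

instance (N : ℕ) : Algebra ℂ (Pol N) := inferInstanceAs (Algebra ℂ (RingQuot (Rel N)))

/-- The generators `u_{ij}`. -/
def gen (N : ℕ) (i j : Fin N) : Pol N := RingQuot.mkAlgHom ℂ (Rel N) (FreeAlgebra.ι ℂ (i, j))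

theorem gen_row (N : ℕ) (i j : Fin N) :
    ∑ k, gen N i k * gen N j k = if i = j then 1 else 0 := by
  have h := RingQuot.mkAlgHom_rel ℂ (Rel.row (N := N) i j)
  rw [map_sum] at h
  simp only [map_mul] at h
  refine h.trans ?_
  split_ifs
  · exact map_one _
  · exact map_zero _

theorem gen_col (N : ℕ) (i j : Fin N) :
    ∑ k, gen N k i * gen N k j = if i = j then 1 else 0 := by
  have h := RingQuot.mkAlgHom_rel ℂ (Rel.col (N := N) i j)
  rw [map_sum] at h
  simp only [map_mul] at h
  refine h.trans ?_
  split_ifs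
  · exact map_one _
  · exact map_zero _

theorem Pol.lift_rel {N : ℕ} {B : Type} [Ring B] [Algebra ℂ B] (v : Fin N → Fin N → B)
    (hrow : ∀ i j, ∑ k, v i k * v j k = if i = j then 1 else 0)
    (hcol : ∀ i j, ∑ k, v k i * v k j = if i = j then 1 else 0)
    ⦃x y : FreeAlgebra ℂ (Fin N × Fin N)⦄ (hxy : Rel N x y) :
    FreeAlgebra.lift ℂ (fun p : Fin N × Fin N => v p.1 p.2) x =
      FreeAlgebra.lift ℂ (fun p : Fin N × Fin N => v p.1 p.2) y := by
  cases hxy with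
  | row i j =>
    rw [map_sum]
    simp only [map_mul, FreeAlgebra.lift_ι_apply, hrow i j]
    split_ifs <;> simp
  | col i j =>
    rw [map_sum]
    simp only [map_mul, FreeAlgebra.lift_ι_apply, hcol i j]
    split_ifs <;> simp

/-- The universal property of `Pol N`. -/
def Pol.lift {N : ℕ} {B : Type} [Ring B] [Algebra ℂ B] (v : Fin N → Fin N → B)
    (hrow : ∀ i j, ∑ k, v i k * v j k = if i = j then 1 else 0)
    (hcol : ∀ i j, ∑ k, v k i * v k j = if i = j then 1 else 0) : Pol N →ₐ[ℂ] B :=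
  RingQuot.liftAlgHom ℂ ⟨FreeAlgebra.lift ℂ fun p : Fin N × Fin N => v p.1 p.2,
    Pol.lift_rel v hrow hcol⟩

theorem Pol.lift_gen {N : ℕ} {B : Type} [Ring B] [Algebra ℂ B] (v : Fin N → Fin N → B)
    (hrow : ∀ i j, ∑ k, v i k * v j k = if i = j then 1 else 0)
    (hcol : ∀ i j, ∑ k, v k i * v k j = if i = j then 1 else 0) (i j : Fin N) :
    Pol.lift v hrow hcol (gen N i j) = v i j := by
  refine (RingQuot.liftAlgHom_mkAlgHom_apply (S := ℂ) (s := Rel N)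
    (FreeAlgebra.lift ℂ fun p : Fin N × Fin N => v p.1 p.2)
    (Pol.lift_rel v hrow hcol) (FreeAlgebra.ι ℂ (i, j))).trans ?_
  simp

/-- Two algebra homomorphisms on `Pol N` agreeing on the generators are equal. -/
theorem Pol.hom_ext {N : ℕ} {B : Type} [Ring B] [Algebra ℂ B] {f g : Pol N →ₐ[ℂ] B}
    (h : ∀ i j, f (gen N i j) = g (gen N i j)) : f = g := by
  refine RingQuot.ringQuot_ext' ℂ f g ?_
  refine FreeAlgebra.hom_ext ?_
  funext p
  exact h p.1 p.2

/-- The conjugate opposite algebra of `Pol N`, used to construct the involution. -/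
def ConjOp (N : ℕ) : Type := (Pol N)ᵐᵒᵖ

instance (N : ℕ) : Ring (ConjOp N) := inferInstanceAs (Ring (Pol N)ᵐᵒᵖ)

instance (N : ℕ) : Algebra ℂ (ConjOp N) :=
  RingHom.toAlgebra'
    { toFun := fun c => MulOpposite.op (algebraMap ℂ (Pol N) (starRingEnd ℂ c))
      map_one' := congrArg MulOpposite.op (by simp)
      map_mul' := fun a b => congrArg MulOpposite.op (by
        rw [map_mul, map_mul]
        exact Algebra.commutes _ _)
      map_zero' := congrArg MulOpposite.op (by simp)
      map_add' := fun a b => congrArg MulOpposite.op (by simp) }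
    fun c x => congrArg MulOpposite.op
      (Algebra.commutes (A := Pol N) (starRingEnd ℂ c)
        (MulOpposite.unop (α := Pol N) x)).symm

/-- The involution of `Pol N`, as a homomorphism to the conjugate opposite algebra. -/
def starHom (N : ℕ) : Pol N →ₐ[ℂ] ConjOp N :=
  Pol.lift (B := ConjOp N) (fun i j => (MulOpposite.op (gen N i j) : (Pol N)ᵐᵒᵖ))
    (fun i j => by
      have h := congrArg MulOpposite.op (gen_row N j i)
      refine Eq.trans ?_ (h.trans ?_)
      · exact (map_sum (MulOpposite.opAddEquiv (α := Pol N)) _ Finset.univ).symm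
      · by_cases hij : i = j
        · rw [if_pos hij, if_pos hij.symm]; rfl
        · rw [if_neg hij, if_neg (Ne.symm hij)]; rfl)
    (fun i j => by
      have h := congrArg MulOpposite.op (gen_col N j i)
      refine Eq.trans ?_ (h.trans ?_)
      · exact (map_sum (MulOpposite.opAddEquiv (α := Pol N)) _ Finset.univ).symm
      · by_cases hij : i = j
        · rw [if_pos hij, if_pos hij.symm]; rfl
        · rw [if_neg hij, if_neg (Ne.symm hij)]; rfl)

/-- The underlying map of the involution: the conjugate-linear anti-multiplicative map that fixes
the generators. -/
def starFun (N : ℕ) (x : Pol N) : Pol N :=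
  let y : ConjOp N := starHom N x
  MulOpposite.unop (α := Pol N) y

theorem starFun_gen (N : ℕ) (i j : Fin N) : starFun N (gen N i j) = gen N i j :=
  congrArg (fun z : ConjOp N => MulOpposite.unop (α := Pol N) z) (Pol.lift_gen _ _ _ i j)

theorem starFun_mul (N : ℕ) (x y : Pol N) :
    starFun N (x * y) = starFun N y * starFun N x :=
  congrArg (fun z : ConjOp N => MulOpposite.unop (α := Pol N) z) (map_mul (starHom N) x y)

theorem starFun_add (N : ℕ) (x y : Pol N) :
    starFun N (x + y) = starFun N x + starFun N y :=
  congrArg (fun z : ConjOp N => MulOpposite.unop (α := Pol N) z) (map_add (starHom N) x y)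

theorem starFun_algebraMap (N : ℕ) (c : ℂ) :
    starFun N (algebraMap ℂ (Pol N) c) = algebraMap ℂ (Pol N) (starRingEnd ℂ c) :=
  congrArg (fun z : ConjOp N => MulOpposite.unop (α := Pol N) z)
    ((starHom N).commutes c)

theorem starFun_starFun (N : ℕ) (x : Pol N) : starFun N (starFun N x) = x := by
  let f : Pol N →ₐ[ℂ] Pol N :=
    { toFun := fun x => starFun N (starFun N x)
      map_one' := by
        have h := starFun_algebraMap N 1
        simp only [map_one] at h
        rw [h, h]
      map_mul' := fun x y => by rw [starFun_mul, starFun_mul]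
      map_zero' := by
        have h := starFun_algebraMap N 0
        simp only [map_zero] at h
        rw [h, h]
      map_add' := fun x y => by rw [starFun_add, starFun_add]
      commutes' := fun c => by
        rw [starFun_algebraMap, starFun_algebraMap, Complex.conj_conj] }
  have hf : f = AlgHom.id ℂ (Pol N) := Pol.hom_ext fun i j => by
    change starFun N (starFun N (gen N i j)) = gen N i j
    rw [starFun_gen, starFun_gen]
  exact congrArg (fun g : Pol N →ₐ[ℂ] Pol N => g x) hf

instance (N : ℕ) : StarRing (Pol N) where
  star := starFun N
  star_involutive := starFun_starFun N
  star_mul := starFun_mul N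
  star_add := starFun_add N

theorem star_gen (N : ℕ) (i j : Fin N) : star (gen N i j) = gen N i j := starFun_gen N i j

instance (N : ℕ) : StarModule ℂ (Pol N) where
  star_smul c x := by
    rw [Algebra.smul_def, star_mul, Algebra.smul_def]
    have h : star (algebraMap ℂ (Pol N) c) = algebraMap ℂ (Pol N) (star c) :=
      starFun_algebraMap N c
    rw [h, Algebra.commutes]

/-- The coproduct, `Δ(u_{ij}) = ∑_k u_{ik} ⊗ u_{kj}`. -/
def comul (N : ℕ) : Pol N →ₐ[ℂ] Pol N ⊗[ℂ] Pol N :=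
  Pol.lift (fun i j => ∑ k, gen N i k ⊗ₜ[ℂ] gen N k j)
    (fun i j => calc
      _ = ∑ a, ∑ b, (gen N i a * gen N j b) ⊗ₜ[ℂ] (∑ k, gen N a k * gen N b k) := by
        simp only [Finset.sum_mul_sum, Algebra.TensorProduct.tmul_mul_tmul,
          TensorProduct.tmul_sum]
        rw [Finset.sum_comm]
        exact Finset.sum_congr rfl fun a _ => Finset.sum_comm
      _ = (∑ a, gen N i a * gen N j a) ⊗ₜ[ℂ] 1 := by
        rw [TensorProduct.sum_tmul]
        simp only [gen_row N _ _, TensorProduct.tmul_ite, Finset.sum_ite_eq, Finset.mem_univ,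
          if_true]
      _ = _ := by
        rw [gen_row]
        split_ifs
        · rfl
        · simp)
    (fun i j => calc
      _ = ∑ a, ∑ b, (∑ k, gen N k a * gen N k b) ⊗ₜ[ℂ] (gen N a i * gen N b j) := by
        simp only [Finset.sum_mul_sum, Algebra.TensorProduct.tmul_mul_tmul,
          TensorProduct.sum_tmul]
        rw [Finset.sum_comm]
        exact Finset.sum_congr rfl fun a _ => Finset.sum_comm
      _ = 1 ⊗ₜ[ℂ] (∑ a, gen N a i * gen N a j) := by
        rw [TensorProduct.tmul_sum]
        simp only [gen_col N _ _, TensorProduct.ite_tmul, Finset.sum_ite_eq, Finset.mem_univ,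
          if_true]
      _ = _ := by
        rw [gen_col]
        split_ifs
        · rfl
        · simp)

theorem comul_gen (N : ℕ) (i j : Fin N) :
    comul N (gen N i j) = ∑ k, gen N i k ⊗ₜ[ℂ] gen N k j :=
  Pol.lift_gen _ _ _ i j

/-- The matrix coefficient `u_{i_1 j_1} ⋯ u_{i_n j_n}` of the corepresentation `u^{⊗n}`. -/
def genPow (N n : ℕ) (i j : Fin n → Fin N) : Pol N :=
  (List.ofFn fun k => gen N (i k) (j k)).prod

/-- The Haar state `h`: the bi-invariant state, `(h ⊗ id)Δ = h(·)1 = (id ⊗ h)Δ`. -/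
structure HaarState (N : ℕ) where
  /-- The underlying linear form. -/
  form : Pol N →ₗ[ℂ] ℂ
  map_one : form 1 = 1
  nonneg : ∀ x, 0 ≤ form (star x * x)
  left_inv : ∀ x, TensorProduct.lid ℂ (Pol N) (form.rTensor (Pol N) (comul N x)) = form x • 1
  right_inv : ∀ x, TensorProduct.rid ℂ (Pol N) (form.lTensor (Pol N) (comul N x)) = form x • 1

/-- A state is hermitian. -/
theorem HaarState.form_star {N : ℕ} (h : HaarState N) (x : Pol N) :
    h.form (star x) = starRingEnd ℂ (h.form x) := by
  have key : ∀ y : Pol N, (h.form y + h.form (star y)).im = 0 := by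
    intro y
    have h1 := (Complex.nonneg_iff.1 (h.nonneg (y + 1))).2
    have h2 := (Complex.nonneg_iff.1 (h.nonneg y)).2
    have e : star (y + 1) * (y + 1) = star y * y + (y + star y) + 1 := by
      rw [star_add, star_one]
      noncomm_ring
    rw [e, map_add, map_add, map_add, h.map_one] at h1
    simp only [Complex.add_im, Complex.one_im, ← h2] at h1 ⊢
    linarith
  have h1 := key x
  have h2 := key (Complex.I • x)
  rw [star_smul, map_smul, map_smul] at h2
  simp only [smul_eq_mul, Complex.add_im, Complex.mul_im, Complex.I_re, Complex.I_im,
    Complex.star_def, Complex.conj_I, Complex.neg_re, Complex.neg_im] at h1 h2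
  apply Complex.ext
  · rw [Complex.conj_re]; linarith
  · rw [Complex.conj_im]; linarith

/-! ### Construction of the Haar state -/

theorem genPow_append (N : ℕ) {m n : ℕ} (x x' : Fin m → Fin N) (y y' : Fin n → Fin N) :
    genPow N (m + n) (Fin.append x y) (Fin.append x' y') = genPow N m x x' * genPow N n y y' := by
  unfold genPow
  rw [← List.prod_append, ← List.ofFn_fin_append]
  congr 2
  funext k
  refine Fin.addCases (fun k => ?_) (fun k => ?_) k <;> simp

theorem genPow_two (N : ℕ) (a b c e : Fin N) :
    genPow N 2 ![a, b] ![c, e] = gen N a c * gen N b e := by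
  simp [genPow]

theorem genPow_succ (N n : ℕ) (x y : Fin (n + 1) → Fin N) :
    genPow N (n + 1) x y = gen N (x 0) (y 0) * genPow N n (x ∘ Fin.succ) (y ∘ Fin.succ) := by
  unfold genPow
  rw [List.ofFn_succ, List.prod_cons]
  rfl

theorem genPow_snoc (N n : ℕ) (x y : Fin (n + 1) → Fin N) :
    genPow N (n + 1) x y = genPow N n (x ∘ Fin.castSucc) (y ∘ Fin.castSucc) *
      gen N (x (Fin.last n)) (y (Fin.last n)) := by
  unfold genPow
  rw [List.ofFn_succ', List.concat_eq_append, List.prod_append, List.prod_singleton]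
  rfl

theorem star_genPow (N n : ℕ) (x y : Fin n → Fin N) :
    star (genPow N n x y) = genPow N n (x ∘ Fin.rev) (y ∘ Fin.rev) := by
  induction n with
  | zero => simp [genPow]
  | succ n ih =>
    rw [genPow_succ, star_mul, ih, star_gen, genPow_snoc]
    congr 2
    · funext k; simp [Fin.rev_castSucc]
    · funext k; simp [Fin.rev_castSucc]
    · simp
    · simp

theorem comul_genPow (N n : ℕ) (x y : Fin n → Fin N) :
    comul N (genPow N n x y) = ∑ z, genPow N n x z ⊗ₜ[ℂ] genPow N n z y := by
  induction n with
  | zero => simp [genPow, Algebra.TensorProduct.one_def]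
  | succ n ih =>
    rw [genPow_succ, map_mul, comul_gen, ih,
      ← (Fin.consEquiv fun _ : Fin (n + 1) => Fin N).sum_comp, Fintype.sum_prod_type,
      Finset.sum_mul_sum]
    refine Finset.sum_congr rfl fun a _ => Finset.sum_congr rfl fun z _ => ?_
    rw [Algebra.TensorProduct.tmul_mul_tmul, genPow_succ, genPow_succ]
    rfl

theorem genPow_row (N n : ℕ) (x y : Fin n → Fin N) :
    ∑ z, genPow N n x z * star (genPow N n y z) = if x = y then 1 else 0 := by
  induction n with
  | zero => simp [genPow, Subsingleton.elim x y]
  | succ n ih =>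
    rw [← (Fin.consEquiv fun _ : Fin (n + 1) => Fin N).sum_comp, Fintype.sum_prod_type]
    calc _ = ∑ a, gen N (x 0) a * (∑ z, genPow N n (x ∘ Fin.succ) z *
          star (genPow N n (y ∘ Fin.succ) z)) * gen N (y 0) a := by
          refine Finset.sum_congr rfl fun a _ => ?_
          rw [Finset.mul_sum, Finset.sum_mul]
          refine Finset.sum_congr rfl fun z _ => ?_
          rw [genPow_succ, genPow_succ, star_mul, star_gen]
          simp only [mul_assoc]
          rfl
      _ = _ := by
          rw [ih]
          by_cases h : x ∘ Fin.succ = y ∘ Fin.succ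
          · simp only [h, if_true, mul_one, gen_row]
            have : x 0 = y 0 ↔ x = y := by
              refine ⟨fun h0 => ?_, fun h => by rw [h]⟩
              funext k
              exact Fin.cases h0 (fun k => congrFun h k) k
            simp only [this]
          · have : x ≠ y := fun e => h (by rw [e])
            simp [h, this]

theorem genPow_col (N n : ℕ) (x y : Fin n → Fin N) :
    ∑ z, star (genPow N n z x) * genPow N n z y = if x = y then 1 else 0 := by
  induction n with
  | zero => simp [genPow, Subsingleton.elim x y]
  | succ n ih =>
    rw [← (Fin.consEquiv fun _ : Fin (n + 1) => Fin N).sum_comp, Fintype.sum_prod_type,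
      Finset.sum_comm]
    calc _ = ∑ z, star (genPow N n z (x ∘ Fin.succ)) * (∑ a, gen N a (x 0) * gen N a (y 0)) *
            genPow N n z (y ∘ Fin.succ) := by
          refine Finset.sum_congr rfl fun z _ => ?_
          rw [Finset.mul_sum, Finset.sum_mul]
          refine Finset.sum_congr rfl fun a _ => ?_
          rw [genPow_succ, genPow_succ, star_mul, star_gen]
          simp only [mul_assoc]
          rfl
      _ = _ := by
          rw [gen_col]
          by_cases h : x 0 = y 0
          · simp only [h, if_true, mul_one, ih]
            have : x ∘ Fin.succ = y ∘ Fin.succ ↔ x = y := by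
              refine ⟨fun h0 => ?_, fun h => by rw [h]⟩
              funext k
              exact Fin.cases h (fun k => congrFun h0 k) k
            simp only [this]
          · have : x ≠ y := fun e => h (by rw [e])
            simp [h, this]

/-- The linear span of the coefficients of the `u^{⊗n}` is everything. -/
theorem span_genPow (N : ℕ) :
    Submodule.span ℂ {x : Pol N | ∃ n i j, x = genPow N n i j} = ⊤ := by
  rw [eq_top_iff]
  rintro x -
  obtain ⟨y, rfl⟩ := RingQuot.mkAlgHom_surjective ℂ (Rel N) x
  let S : Submodule ℂ (Pol N) := Submodule.span ℂ {x : Pol N | ∃ n i j, x = genPow N n i j}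
  have hone : (1 : Pol N) ∈ S :=
    Submodule.subset_span ⟨0, Fin.elim0, Fin.elim0, by simp [genPow]⟩
  have hmul : ∀ x ∈ S, ∀ y ∈ S, x * y ∈ S := by
    intro x hx y hy
    induction hx using Submodule.span_induction with
    | zero => rw [zero_mul]; exact S.zero_mem
    | add a b _ _ ha hb => rw [add_mul]; exact S.add_mem ha hb
    | smul c a _ ha => rw [smul_mul_assoc]; exact S.smul_mem c ha
    | mem a ha =>
      obtain ⟨m, i, j, rfl⟩ := ha
      induction hy using Submodule.span_induction with
      | zero => rw [mul_zero]; exact S.zero_mem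
      | add a b _ _ ha hb => rw [mul_add]; exact S.add_mem ha hb
      | smul c a _ ha => rw [mul_smul_comm]; exact S.smul_mem c ha
      | mem b hb =>
        obtain ⟨n, i', j', rfl⟩ := hb
        exact Submodule.subset_span ⟨m + n, Fin.append i i', Fin.append j j',
          (genPow_append N i j i' j').symm⟩
  change (RingQuot.mkAlgHom ℂ (Rel N) y : Pol N) ∈ S
  induction y using FreeAlgebra.induction with
  | grade0 r =>
    have e : RingQuot.mkAlgHom ℂ (Rel N) (algebraMap ℂ _ r) = r • (1 : Pol N) := by
      rw [AlgHom.commutes]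
      exact Algebra.algebraMap_eq_smul_one r
    rw [e]
    exact S.smul_mem r hone
  | grade1 p =>
    exact Submodule.subset_span ⟨1, fun _ => p.1, fun _ => p.2, by
      rw [genPow_succ]; simp [genPow]; rfl⟩
  | mul a b ha hb => rw [map_mul]; exact hmul _ ha _ hb
  | add a b ha hb => rw [map_add]; exact S.add_mem ha hb

/-- The fixed vectors of the corepresentation `u^{⊗n}`. -/
def fixSpace (N n : ℕ) : Submodule ℂ (TPow N n) where
  carrier := {ξ | ∀ x, ∑ y, ξ y • genPow N n x y = ξ x • 1}
  add_mem' {ξ η} hξ hη x := by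
    simp only [PiLp.add_apply, add_smul, Finset.sum_add_distrib]
    rw [hξ x, hη x]
  zero_mem' x := by simp
  smul_mem' c ξ hξ x := by
    simp only [PiLp.smul_apply, smul_eq_mul, mul_smul, ← Finset.smul_sum]
    rw [hξ x]

/-- The matrix of the orthogonal projection onto the fixed vectors of `u^{⊗n}`. -/
def fixMat (N n : ℕ) (x y : Fin n → Fin N) : ℂ :=
  (fixSpace N n).starProjection (EuclideanSpace.single y 1) x

theorem fixMat_fix (N n : ℕ) (x y : Fin n → Fin N) :
    ∑ z, fixMat N n z y • genPow N n x z = fixMat N n x y • 1 :=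
  ((fixSpace N n).starProjection_apply_mem (EuclideanSpace.single y 1)) x

theorem starProjection_apply' (N n : ℕ) (ξ : TPow N n) (x : Fin n → Fin N) :
    (fixSpace N n).starProjection ξ x = ∑ y, fixMat N n x y * ξ y := by
  have h : ξ = ∑ y, ξ y • EuclideanSpace.single y (1 : ℂ) := by
    ext z
    simp [Finset.sum_apply, Pi.single_apply]
  conv_lhs => rw [h]
  rw [map_sum]
  simp [fixMat, mul_comm]

theorem conj_fixMat (N n : ℕ) (x y : Fin n → Fin N) :
    starRingEnd ℂ (fixMat N n x y) = fixMat N n y x := by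
  have h := (fixSpace N n).inner_starProjection_left_eq_right
    (EuclideanSpace.single y 1) (EuclideanSpace.single x 1)
  rw [EuclideanSpace.inner_single_right, EuclideanSpace.inner_single_left] at h
  simpa [fixMat] using h

theorem fixMat_mul (N n : ℕ) (x y : Fin n → Fin N) :
    ∑ z, fixMat N n x z * fixMat N n z y = fixMat N n x y := by
  have h := starProjection_apply' N n
    ((fixSpace N n).starProjection (EuclideanSpace.single y 1)) x
  rw [Submodule.starProjection_eq_self_iff.2 (Submodule.starProjection_apply_mem _ _)] at h
  exact h.symm

/-- Splitting of words of length `p + 2 + q`. -/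
def splitEquiv (N p q : ℕ) : ((Fin p → Fin N) × (Fin 2 → Fin N)) × (Fin q → Fin N) ≃
    (Fin (p + 2 + q) → Fin N) :=
  ((Fin.appendEquiv p 2).prodCongr (Equiv.refl _)).trans (Fin.appendEquiv (p + 2) q)

theorem splitEquiv_apply (N p q : ℕ) (x : Fin p → Fin N) (b : Fin 2 → Fin N)
    (y : Fin q → Fin N) : splitEquiv N p q ((x, b), y) = Fin.append (Fin.append x b) y := rfl

theorem sum_two (N : ℕ) {A : Type} [AddCommMonoid A] (f : (Fin 2 → Fin N) → A) :
    ∑ b, f b = ∑ a, ∑ c, f ![a, c] := by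
  rw [← (finTwoArrowEquiv (Fin N)).symm.sum_comp, Fintype.sum_prod_type]
  rfl

theorem sum_split (N p q : ℕ) {A : Type} [AddCommMonoid A] (f : (Fin (p + 2 + q) → Fin N) → A) :
    ∑ z, f z = ∑ x, ∑ y, ∑ a, ∑ c, f (Fin.append (Fin.append x ![a, c]) y) := by
  rw [← (splitEquiv N p q).sum_comp, Fintype.sum_prod_type, Fintype.sum_prod_type]
  refine Finset.sum_congr rfl fun x _ => ?_
  rw [Finset.sum_comm]
  refine Finset.sum_congr rfl fun y _ => ?_
  rw [sum_two]
  rfl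

theorem sum_append (N p q : ℕ) {A : Type} [AddCommMonoid A] (f : (Fin (p + q) → Fin N) → A) :
    ∑ z, f z = ∑ x, ∑ y, f (Fin.append x y) := by
  rw [← (Fin.appendEquiv p q).sum_comp, Fintype.sum_prod_type]
  rfl

theorem genPow_split (N : ℕ) {p q : ℕ} (x x' : Fin p → Fin N) (y y' : Fin q → Fin N)
    (a b c e : Fin N) :
    genPow N (p + 2 + q) (Fin.append (Fin.append x ![a, b]) y)
      (Fin.append (Fin.append x' ![c, e]) y') =
    genPow N p x x' * (gen N a c * gen N b e) * genPow N q y y' := by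
  rw [genPow_append, genPow_append, genPow_two]

/-- The insertion `id_p ⊗ t ⊗ id_q`. -/
def insT (N p q : ℕ) (η : TPow N (p + q)) : TPow N (p + 2 + q) :=
  WithLp.toLp 2 fun z =>
    let w := (splitEquiv N p q).symm z
    if w.1.2 0 = w.1.2 1 then η (Fin.append w.1.1 w.2) else 0

theorem insT_apply (N p q : ℕ) (η : TPow N (p + q)) (x : Fin p → Fin N) (y : Fin q → Fin N)
    (a b : Fin N) : insT N p q η (Fin.append (Fin.append x ![a, b]) y) =
      if a = b then η (Fin.append x y) else 0 := by
  have h : (splitEquiv N p q).symm (Fin.append (Fin.append x ![a, b]) y) = ((x, ![a, b]), y) := by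
    rw [Equiv.symm_apply_eq]
    rfl
  simp [insT, h]

/-- The contraction `id_p ⊗ t^* ⊗ id_q`. -/
def conT (N p q : ℕ) (ζ : TPow N (p + 2 + q)) : TPow N (p + q) :=
  WithLp.toLp 2 fun z =>
    let w := (Fin.appendEquiv p q).symm z
    ∑ a, ζ (Fin.append (Fin.append w.1 ![a, a]) w.2)

theorem conT_apply (N p q : ℕ) (ζ : TPow N (p + 2 + q)) (x : Fin p → Fin N)
    (y : Fin q → Fin N) : conT N p q ζ (Fin.append x y) =
      ∑ a, ζ (Fin.append (Fin.append x ![a, a]) y) := by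
  simp [conT]

theorem exists_split (N p q : ℕ) (z : Fin (p + 2 + q) → Fin N) :
    ∃ x : Fin p → Fin N, ∃ a b : Fin N, ∃ y : Fin q → Fin N,
      z = Fin.append (Fin.append x ![a, b]) y := by
  obtain ⟨⟨⟨x, b⟩, y⟩, rfl⟩ := (splitEquiv N p q).surjective z
  refine ⟨x, b 0, b 1, y, ?_⟩
  rw [splitEquiv_apply]
  congr 2
  funext k
  fin_cases k <;> rfl

theorem exists_append (N p q : ℕ) (z : Fin (p + q) → Fin N) :
    ∃ x : Fin p → Fin N, ∃ y : Fin q → Fin N, z = Fin.append x y := by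
  obtain ⟨⟨x, y⟩, rfl⟩ := (Fin.appendEquiv p q).surjective z
  exact ⟨x, y, rfl⟩

theorem insT_mem (N p q : ℕ) {η : TPow N (p + q)} (hη : η ∈ fixSpace N (p + q)) :
    insT N p q η ∈ fixSpace N (p + 2 + q) := by
  intro z
  obtain ⟨x, a, b, y, rfl⟩ := exists_split N p q z
  rw [sum_split]
  simp only [insT_apply, genPow_split]
  have h := hη (Fin.append x y)
  rw [sum_append] at h
  simp only [genPow_append] at h
  calc _ = ∑ x', ∑ y', η (Fin.append x' y') •
          (genPow N p x x' * (∑ c, gen N a c * gen N b c) * genPow N q y y') := by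
        refine Finset.sum_congr rfl fun x' _ => Finset.sum_congr rfl fun y' _ => ?_
        simp only [ite_smul, zero_smul, Finset.sum_ite_eq, Finset.mem_univ, if_true,
          Finset.mul_sum, Finset.sum_mul, Finset.smul_sum]
    _ = _ := by
        rw [gen_row]
        by_cases hab : a = b
        · simp only [hab, if_true, mul_one, h]
        · simp [hab]

theorem conT_mem (N p q : ℕ) {ζ : TPow N (p + 2 + q)} (hζ : ζ ∈ fixSpace N (p + 2 + q)) :
    conT N p q ζ ∈ fixSpace N (p + q) := by
  intro z
  obtain ⟨x, y, rfl⟩ := exists_append N p q z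
  rw [sum_append]
  simp only [conT_apply, genPow_append]
  calc _ = ∑ x', ∑ y', ∑ a, ∑ b, ζ (Fin.append (Fin.append x' ![a, b]) y') •
          (genPow N p x x' * (∑ c, gen N c a * gen N c b) * genPow N q y y') := by
        refine Finset.sum_congr rfl fun x' _ => Finset.sum_congr rfl fun y' _ => ?_
        rw [Finset.sum_smul]
        refine Finset.sum_congr rfl fun a _ => ?_
        simp only [gen_col]
        rw [Finset.sum_eq_single a]
        · simp
        · intro b _ hb
          simp [Ne.symm hb]
        · simp
    _ = ∑ c, ∑ w, ζ w • genPow N (p + 2 + q) (Fin.append (Fin.append x ![c, c]) y) w := by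
        simp only [sum_split, genPow_split, Finset.mul_sum, Finset.sum_mul, Finset.smul_sum]
        symm
        rw [Finset.sum_comm]
        refine Finset.sum_congr rfl fun x' _ => ?_
        rw [Finset.sum_comm]
        refine Finset.sum_congr rfl fun y' _ => ?_
        rw [Finset.sum_comm]
        refine Finset.sum_congr rfl fun a _ => ?_
        rw [Finset.sum_comm]
    _ = _ := by
        rw [Finset.sum_smul]
        exact Finset.sum_congr rfl fun c _ => hζ _

theorem inner_insT (N p q : ℕ) (ζ : TPow N (p + 2 + q)) (η : TPow N (p + q)) :
    inner ℂ ζ (insT N p q η) = inner ℂ (conT N p q ζ) η := by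
  simp only [PiLp.inner_apply]
  rw [sum_split, sum_append]
  refine Finset.sum_congr rfl fun x _ => Finset.sum_congr rfl fun y _ => ?_
  simp only [insT_apply, conT_apply]
  simp [apply_ite, Finset.mul_sum]

theorem insT_single (N p q : ℕ) (x : Fin p → Fin N) (y : Fin q → Fin N) :
    insT N p q (EuclideanSpace.single (Fin.append x y) 1) =
      ∑ a, EuclideanSpace.single (Fin.append (Fin.append x ![a, a]) y) (1 : ℂ) := by
  refine ext_inner_left ℂ fun ζ => ?_
  rw [inner_insT, inner_sum]
  simp [EuclideanSpace.inner_single_right, conT_apply]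

theorem insT_sub (N p q : ℕ) (η ξ : TPow N (p + q)) :
    insT N p q (η - ξ) = insT N p q η - insT N p q ξ := by
  refine ext_inner_left ℂ fun ζ => ?_
  rw [inner_sub_right]
  simp only [inner_insT, inner_sub_right]

/-- The projections onto the fixed vectors intertwine the insertions of `t`. -/
theorem fixMat_ins (N p q : ℕ) (z : Fin (p + 2 + q) → Fin N) (x : Fin p → Fin N)
    (y : Fin q → Fin N) :
    ∑ a, fixMat N (p + 2 + q) z (Fin.append (Fin.append x ![a, a]) y) =
      insT N p q ((fixSpace N (p + q)).starProjection
        (EuclideanSpace.single (Fin.append x y) 1)) z := by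
  have h : insT N p q ((fixSpace N (p + q)).starProjection
        (EuclideanSpace.single (Fin.append x y) 1)) = (fixSpace N (p + 2 + q)).starProjection
        (insT N p q (EuclideanSpace.single (Fin.append x y) 1)) := by
    refine Submodule.eq_starProjection_of_mem_of_inner_eq_zero
      (insT_mem N p q (Submodule.starProjection_apply_mem _ _)) ?_ |>.symm
    intro ζ hζ
    rw [← insT_sub, ← inner_conj_symm, inner_insT, ← inner_conj_symm (conT N p q ζ),
      Submodule.starProjection_inner_eq_zero _ _ (conT_mem N p q hζ)]
    simp
  rw [h, insT_single, map_sum]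
  simp [fixMat]

theorem fixMat_row (N p q : ℕ) (x x' : Fin p → Fin N) (y y' : Fin q → Fin N) (a b : Fin N) :
    ∑ c, fixMat N (p + 2 + q) (Fin.append (Fin.append x ![a, b]) y)
      (Fin.append (Fin.append x' ![c, c]) y') =
      if a = b then fixMat N (p + q) (Fin.append x y) (Fin.append x' y') else 0 := by
  rw [fixMat_ins, insT_apply]
  rfl

theorem fixMat_col (N p q : ℕ) (x x' : Fin p → Fin N) (y y' : Fin q → Fin N) (a b : Fin N) :
    ∑ c, fixMat N (p + 2 + q) (Fin.append (Fin.append x ![c, c]) y)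
      (Fin.append (Fin.append x' ![a, b]) y') =
      if a = b then fixMat N (p + q) (Fin.append x y) (Fin.append x' y') else 0 := by
  have h := congrArg (starRingEnd ℂ) (fixMat_row N p q x' x y' y a b)
  rw [map_sum] at h
  simpa only [conj_fixMat, apply_ite (starRingEnd ℂ), map_zero] using h

/-- The functions on words in the letters `u_{ij}` that respect the relations of `Pol N`. -/
def relMod (N : ℕ) : Submodule ℂ (List (Fin N × Fin N) → ℂ) where
  carrier := {φ | ∀ w w' i j,
    (∑ k, φ (w ++ (i, k) :: (j, k) :: w') = if i = j then φ (w ++ w') else 0) ∧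
    (∑ k, φ (w ++ (k, i) :: (k, j) :: w') = if i = j then φ (w ++ w') else 0)}
  add_mem' {φ ψ} hφ hψ w w' i j := by
    simp only [Pi.add_apply, Finset.sum_add_distrib, (hφ w w' i j).1, (hψ w w' i j).1,
      (hφ w w' i j).2, (hψ w w' i j).2]
    split_ifs <;> simp
  zero_mem' w w' i j := by simp
  smul_mem' c φ hφ w w' i j := by
    simp only [Pi.smul_apply, ← Finset.smul_sum, (hφ w w' i j).1, (hφ w w' i j).2]
    split_ifs <;> simp

/-- The action of a letter. -/
def shift (N : ℕ) (p : Fin N × Fin N) : Module.End ℂ (relMod N) where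
  toFun φ := ⟨fun w => φ.1 (w ++ [p]), fun w w' i j => by
    have h := φ.2 w (w' ++ [p]) i j
    simpa using h⟩
  map_add' φ ψ := rfl
  map_smul' c φ := rfl

theorem sum_coe_apply (N : ℕ) (f : Fin N → relMod N) (w : List (Fin N × Fin N)) :
    (∑ k, f k).1 w = ∑ k, (f k).1 w := by
  have h : (∑ k, f k).1 = ∑ k, (f k).1 := map_sum (relMod N).subtype f Finset.univ
  rw [h, Finset.sum_apply]

/-- The corresponding representation of `Pol N`. -/
def wordRep (N : ℕ) : Pol N →ₐ[ℂ] Module.End ℂ (relMod N) :=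
  Pol.lift (fun i j => shift N (i, j))
    (fun i j => by
      refine LinearMap.ext fun φ => Subtype.ext (funext fun w => ?_)
      rw [LinearMap.sum_apply, sum_coe_apply]
      have h := (φ.2 w [] i j).1
      by_cases hij : i = j
      · simpa [hij, shift] using h
      · simpa [hij, shift] using h)
    (fun i j => by
      refine LinearMap.ext fun φ => Subtype.ext (funext fun w => ?_)
      rw [LinearMap.sum_apply, sum_coe_apply]
      have h := (φ.2 w [] i j).2
      by_cases hij : i = j
      · simpa [hij, shift] using h
      · simpa [hij, shift] using h)

theorem wordRep_genPow (N n : ℕ) (x y : Fin n → Fin N) (φ : relMod N)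
    (w : List (Fin N × Fin N)) : (wordRep N (genPow N n x y) φ).1 w =
      φ.1 (w ++ List.ofFn fun k => (x k, y k)) := by
  induction n generalizing w with
  | zero => simp [genPow]
  | succ n ih =>
    rw [genPow_succ, map_mul, wordRep, Pol.lift_gen, ← wordRep]
    change (wordRep N (genPow N n (x ∘ Fin.succ) (y ∘ Fin.succ)) φ).1 (w ++ [(x 0, y 0)]) = _
    rw [ih, List.ofFn_succ]
    simp

/-- The entries of the projections `fixMat`, as a function on words. -/
def fixFun (N : ℕ) (w : List (Fin N × Fin N)) : ℂ :=
  let s := List.equivSigmaTuple w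
  fixMat N s.1 (fun k => (s.2 k).1) (fun k => (s.2 k).2)

theorem fixFun_ofFn (N n : ℕ) (x y : Fin n → Fin N) :
    fixFun N (List.ofFn fun k => (x k, y k)) = fixMat N n x y := by
  have h : List.equivSigmaTuple (List.ofFn fun k => (x k, y k)) = ⟨n, fun k => (x k, y k)⟩ :=
    List.equivSigmaTuple.apply_symm_apply ⟨n, fun k => (x k, y k)⟩
  unfold fixFun
  rw [h]

theorem fixFun_append (N p q : ℕ) (x x' : Fin p → Fin N) (y y' : Fin q → Fin N) :
    fixFun N ((List.ofFn fun k => (x k, x' k)) ++ List.ofFn fun k => (y k, y' k)) =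
      fixMat N (p + q) (Fin.append x y) (Fin.append x' y') := by
  rw [← List.ofFn_fin_append, ← fixFun_ofFn]
  congr 2
  funext k
  refine Fin.addCases (fun k => ?_) (fun k => ?_) k <;> simp

theorem fixFun_split (N p q : ℕ) (x x' : Fin p → Fin N) (y y' : Fin q → Fin N)
    (a b c e : Fin N) :
    fixFun N ((List.ofFn fun k => (x k, x' k)) ++ (a, c) :: (b, e) ::
      List.ofFn fun k => (y k, y' k)) =
      fixMat N (p + 2 + q) (Fin.append (Fin.append x ![a, b]) y)
        (Fin.append (Fin.append x' ![c, e]) y') := by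
  rw [← fixFun_append]
  congr 1
  have h : (List.ofFn fun k => (Fin.append x ![a, b] k, Fin.append x' ![c, e] k)) =
      (List.ofFn fun k => (x k, x' k)) ++ [(a, c), (b, e)] := by
    have h2 : [(a, c), (b, e)] = List.ofFn fun k : Fin 2 => (![a, b] k, ![c, e] k) := by
      simp
    rw [h2, ← List.ofFn_fin_append]
    congr 1
    funext k
    refine Fin.addCases (fun k => ?_) (fun k => ?_) k <;> simp
  rw [h]
  simp

theorem fixFun_mem (N : ℕ) : fixFun N ∈ relMod N := by
  intro w w' i j
  have hw : ∀ w : List (Fin N × Fin N), ∃ n, ∃ x y : Fin n → Fin N,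
      w = List.ofFn fun k => (x k, y k) := fun w =>
    ⟨w.length, fun k => (w.get k).1, fun k => (w.get k).2, (List.ofFn_get w).symm⟩
  obtain ⟨p, x, x', rfl⟩ := hw w
  obtain ⟨q, y, y', rfl⟩ := hw w'
  simp only [fixFun_split, fixFun_append]
  exact ⟨fixMat_row N p q x x' y y' i j, fixMat_col N p q x x' y y' i j⟩

/-- The linear form with `h(u^{⊗n}_{xy})` equal to the `(x, y)` entry of the orthogonal projection
onto the fixed vectors of `u^{⊗n}`. -/
def haarForm (N : ℕ) : Pol N →ₗ[ℂ] ℂ where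
  toFun x := (wordRep N x ⟨fixFun N, fixFun_mem N⟩).1 []
  map_add' x y := by rw [map_add]; rfl
  map_smul' c x := by rw [map_smul]; rfl

theorem haarForm_genPow (N n : ℕ) (x y : Fin n → Fin N) :
    haarForm N (genPow N n x y) = fixMat N n x y := by
  change (wordRep N (genPow N n x y) ⟨fixFun N, fixFun_mem N⟩).1 [] = _
  rw [wordRep_genPow, List.nil_append]
  exact fixFun_ofFn N n x y

theorem haarForm_one (N : ℕ) : haarForm N 1 = 1 := by
  have h1 : genPow N 0 Fin.elim0 Fin.elim0 = 1 := by simp [genPow]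
  have h2 : EuclideanSpace.single Fin.elim0 (1 : ℂ) ∈ fixSpace N 0 := by
    intro x
    obtain rfl : x = Fin.elim0 := Subsingleton.elim _ _
    rw [Fintype.sum_subsingleton _ Fin.elim0, h1]
  rw [← h1, haarForm_genPow, fixMat, Submodule.starProjection_eq_self_iff.2 h2]
  change (Pi.single Fin.elim0 1 : (Fin 0 → Fin N) → ℂ) Fin.elim0 = 1
  exact Pi.single_eq_same _ _

/-- The rows of `fixMat` are invariant as well. -/
theorem fixMat_fix' (N n : ℕ) (x y : Fin n → Fin N) :
    ∑ z, fixMat N n x z • genPow N n z y = fixMat N n x y • 1 := by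
  have h : ∑ z, star (genPow N n z y) * (fixMat N n z x • 1) = fixMat N n y x • (1 : Pol N) := by
    simp only [← fixMat_fix, Finset.mul_sum, mul_smul_comm]
    rw [Finset.sum_comm]
    simp only [← Finset.smul_sum, genPow_col]
    simpa using (fixMat_fix N n y x).symm
  have h2 := congrArg star h
  rw [star_sum] at h2
  simpa only [star_smul, star_one, Complex.star_def, conj_fixMat, mul_smul_comm, mul_one,
    star_star] using h2

theorem span_induction_genPow {N : ℕ} {B : Type} [AddCommGroup B] [Module ℂ B]
    {f g : Pol N →ₗ[ℂ] B} (h : ∀ n x y, f (genPow N n x y) = g (genPow N n x y)) : f = g := by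
  refine LinearMap.ext_on (span_genPow N) ?_
  rintro _ ⟨n, x, y, rfl⟩
  exact h n x y

theorem haarForm_left (N : ℕ) (x : Pol N) :
    TensorProduct.lid ℂ (Pol N) ((haarForm N).rTensor (Pol N) (comul N x)) =
      haarForm N x • 1 := by
  let f : Pol N →ₗ[ℂ] Pol N := (TensorProduct.lid ℂ (Pol N)).toLinearMap ∘ₗ
    (haarForm N).rTensor (Pol N) ∘ₗ (comul N).toLinearMap
  have h : f = (haarForm N).smulRight 1 := span_induction_genPow fun n x y => by
    change TensorProduct.lid ℂ (Pol N) ((haarForm N).rTensor (Pol N) (comul N (genPow N n x y))) =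
      haarForm N (genPow N n x y) • 1
    simp only [comul_genPow, map_sum, LinearMap.rTensor_tmul, TensorProduct.lid_tmul,
      haarForm_genPow, fixMat_fix']
  exact congrArg (fun g : Pol N →ₗ[ℂ] Pol N => g x) h

theorem haarForm_right (N : ℕ) (x : Pol N) :
    TensorProduct.rid ℂ (Pol N) ((haarForm N).lTensor (Pol N) (comul N x)) =
      haarForm N x • 1 := by
  let f : Pol N →ₗ[ℂ] Pol N := (TensorProduct.rid ℂ (Pol N)).toLinearMap ∘ₗ
    (haarForm N).lTensor (Pol N) ∘ₗ (comul N).toLinearMap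
  have h : f = (haarForm N).smulRight 1 := span_induction_genPow fun n x y => by
    change TensorProduct.rid ℂ (Pol N) ((haarForm N).lTensor (Pol N) (comul N (genPow N n x y))) =
      haarForm N (genPow N n x y) • 1
    simp only [comul_genPow, map_sum, LinearMap.lTensor_tmul, TensorProduct.rid_tmul,
      haarForm_genPow, fixMat_fix]
  exact congrArg (fun g : Pol N →ₗ[ℂ] Pol N => g x) h

theorem star_haarForm_genPow (N n : ℕ) (x y : Fin n → Fin N) :
    starRingEnd ℂ (fixMat N n (x ∘ Fin.rev) (y ∘ Fin.rev)) = fixMat N n x y := by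
  let R : (Fin n → Fin N) ≃ (Fin n → Fin N) := Equiv.arrowCongr Fin.revPerm (Equiv.refl _)
  have hR : ∀ z, R z = z ∘ Fin.rev := fun z => rfl
  have hRR : ∀ z : Fin n → Fin N, (z ∘ Fin.rev) ∘ Fin.rev = z := fun z => by
    funext k
    simp
  let Q : (Fin n → Fin N) → (Fin n → Fin N) → ℂ := fun x y =>
    starRingEnd ℂ (fixMat N n (x ∘ Fin.rev) (y ∘ Fin.rev))
  have hQ : ∀ x y, Q x y = starRingEnd ℂ (fixMat N n (x ∘ Fin.rev) (y ∘ Fin.rev)) :=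
    fun _ _ => rfl
  have h1 : ∀ x y, ∑ z, Q x z * fixMat N n z y = Q x y := by
    intro x y
    have h := congrArg star (fixMat_fix' N n (x ∘ Fin.rev) (y ∘ Fin.rev))
    rw [star_sum, ← R.sum_comp] at h
    simp only [star_smul, star_one, Complex.star_def, star_genPow, hR, hRR] at h
    have h' := congrArg (haarForm N) h
    simpa only [map_sum, map_smul, haarForm_genPow, haarForm_one, smul_eq_mul, mul_one] using h'
  have h2 : ∀ x y, ∑ z, fixMat N n x z * Q z y = fixMat N n x y := by
    intro x y
    have h := congrArg (starRingEnd ℂ) (h1 (x ∘ Fin.rev) (y ∘ Fin.rev))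
    rw [map_sum, ← R.sum_comp] at h
    simpa only [map_mul, hQ, hR, hRR, Complex.conj_conj] using h
  have h3 : ∀ x y, starRingEnd ℂ (Q x y) = Q y x := fun x y => by
    simp only [hQ, conj_fixMat]
  have h4 := congrArg (starRingEnd ℂ) (h1 y x)
  rw [map_sum, h3] at h4
  simp only [map_mul, h3, conj_fixMat] at h4
  change Q x y = _
  rw [← h4, ← h2 x y]
  exact Finset.sum_congr rfl fun z _ => mul_comm _ _

theorem haarForm_star (N : ℕ) (x : Pol N) :
    haarForm N (star x) = starRingEnd ℂ (haarForm N x) := by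
  have hx : x ∈ Submodule.span ℂ {x : Pol N | ∃ n i j, x = genPow N n i j} := by
    rw [span_genPow]
    trivial
  induction hx using Submodule.span_induction with
  | zero => simp
  | add a b _ _ ha hb => rw [star_add, map_add, map_add, map_add, ha, hb]
  | smul c a _ ha =>
    rw [star_smul, map_smul, map_smul, ha]
    simp
  | mem a ha =>
    obtain ⟨n, i, j, rfl⟩ := ha
    have hRR : ∀ z : Fin n → Fin N, (z ∘ Fin.rev) ∘ Fin.rev = z := fun z => by
      funext k
      simp
    rw [star_genPow, haarForm_genPow, haarForm_genPow, ← star_haarForm_genPow, hRR, hRR]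

/-- Positivity of an invariant hermitian form on the coefficients of a unitary
corepresentation `v`. -/
theorem invariant_nonneg {A : Type} [Ring A] [StarRing A] [Algebra ℂ A] [StarModule ℂ A]
    {I : Type} [Fintype I] [DecidableEq I] (h : A →ₗ[ℂ] ℂ) (v : I → I → A)
    (hstar : ∀ x, h (star x) = starRingEnd ℂ (h x)) (hone : h 1 = 1)
    (hrow : ∀ i j, ∑ k, v i k * star (v j k) = if i = j then 1 else 0)
    (hcol : ∀ i j, ∑ k, star (v k i) * v k j = if i = j then 1 else 0)
    (hinv : ∀ i a k b, ∑ j, ∑ l, h (star (v i j) * v k l) • (star (v j a) * v l b) =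
      h (star (v i a) * v k b) • 1)
    (hsymm : ∀ i j k l, starRingEnd ℂ (h (star (v i j) * v k l)) = h (star (v j i) * v l k))
    (c : I → I → ℂ) :
    0 ≤ h (star (∑ i, ∑ j, c i j • v i j) * ∑ i, ∑ j, c i j • v i j) := by
  let Q : Matrix (I × I) (I × I) ℂ := fun p r => h (star (v p.1 r.1) * v p.2 r.2)
  let M : Matrix (I × I) (I × I) ℂ := fun p r => h (star (v p.1 p.2) * v r.1 r.2)
  let Z : Matrix I I ℂ := fun i r => ∑ k, h (star (v i r) * v k k)
  let B : Matrix ((I × I) × I) I ℂ := fun p r => Q p.1 (r, p.2)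
  have hQQ : ∀ p r, ∑ s, Q p s * Q s r = Q p r := by
    intro p r
    have h1 := congrArg h (hinv p.1 r.1 p.2 r.2)
    rw [map_smul, hone, smul_eq_mul, mul_one, map_sum] at h1
    rw [Fintype.sum_prod_type]
    simpa only [map_sum, map_smul, smul_eq_mul] using h1
  have hQs : ∀ p r, star (Q p r) = Q r p := fun p r => hsymm _ _ _ _
  have hZ : Z = B.conjTranspose * B := by
    ext i r
    rw [Matrix.mul_apply, Fintype.sum_prod_type, Finset.sum_comm]
    refine Finset.sum_congr rfl fun k _ => ?_
    change Q (i, k) (r, k) = ∑ s, star (Q s (i, k)) * Q s (r, k)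
    simp only [hQs]
    exact (hQQ (i, k) (r, k)).symm
  have hB : Function.Injective B.mulVec := by
    have hker : ∀ x : I → ℂ, ∀ k, x k = ∑ j, B.mulVec x ((j, j), k) := by
      intro x k
      simp only [Matrix.mulVec, dotProduct, B, Q]
      rw [Finset.sum_comm]
      simp only [← Finset.sum_mul, ← map_sum, hcol]
      simp [apply_ite h, hone]
    intro x y hxy
    funext k
    rw [hker x k, hker y k]
    simp only [hxy]
  have hZpos : Z.PosDef := by
    rw [hZ]
    exact Matrix.PosDef.conjTranspose_mul_self B hB
  have hMs : M.conjTranspose = M := by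
    ext p r
    change star (h (star (v r.1 r.2) * v p.1 p.2)) = h (star (v p.1 p.2) * v r.1 r.2)
    rw [Complex.star_def, ← hstar, star_mul, star_star]
  -- the averaged elementary matrices commute with `v`
  have hcomm : ∀ i k j s, ∑ l, h (star (v i j) * v k l) • star (v s l) =
      ∑ a, h (star (v i a) * v k s) • star (v a j) := by
    intro i k j s
    calc _ = ∑ l, (h (star (v i j) * v k l) • (1 : A)) * star (v s l) := by simp
      _ = ∑ l, ∑ a, ∑ r, h (star (v i a) * v k r) • (star (v a j) * v r l * star (v s l)) := by
          refine Finset.sum_congr rfl fun l _ => ?_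
          rw [← hinv i j k l]
          simp only [Finset.sum_mul, smul_mul_assoc]
      _ = ∑ a, ∑ r, h (star (v i a) * v k r) • (star (v a j) * ∑ l, v r l * star (v s l)) := by
          rw [Finset.sum_comm]
          refine Finset.sum_congr rfl fun a _ => ?_
          rw [Finset.sum_comm]
          refine Finset.sum_congr rfl fun r _ => ?_
          rw [Finset.mul_sum, Finset.smul_sum]
          simp only [mul_assoc]
      _ = _ := by
          simp only [hrow]
          simp
  have hMM : M * M = (Matrix.kronecker Z (1 : Matrix I I ℂ)) * M := by
    ext ⟨i, j⟩ ⟨p, q⟩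
    rw [Matrix.mul_apply, Matrix.mul_apply, Fintype.sum_prod_type, Fintype.sum_prod_type]
    calc _ = ∑ k, h ((∑ l, h (star (v i j) * v k l) • star (v k l)) * v p q) := by
          simp only [M, Finset.sum_mul, map_sum, smul_mul_assoc, map_smul, smul_eq_mul]
      _ = ∑ a, (∑ k, h (star (v i a) * v k k)) * h (star (v a j) * v p q) := by
          simp only [hcomm, Finset.sum_mul, map_sum, smul_mul_assoc, map_smul, smul_eq_mul]
          rw [Finset.sum_comm]
      _ = _ := by
          refine Finset.sum_congr rfl fun a _ => ?_
          change Z i a * M (a, j) (p, q) =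
            ∑ y, Z i a * (1 : Matrix I I ℂ) j y * M (a, y) (p, q)
          simp only [Matrix.one_apply, mul_ite, mul_one, mul_zero, ite_mul, zero_mul,
            Finset.sum_ite_eq, Finset.mem_univ, if_true]
  let D : Matrix (I × I) (I × I) ℂ := Matrix.kronecker Z (1 : Matrix I I ℂ)
  have hD : D.PosDef := hZpos.kronecker Matrix.PosDef.one
  have hDu : IsUnit D.det := (Matrix.isUnit_iff_isUnit_det _).1 hD.isUnit
  have hMD : M * D = D * M := by
    have h1 := congrArg Matrix.conjTranspose hMM
    rw [Matrix.conjTranspose_mul, Matrix.conjTranspose_mul, hMs] at h1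
    have h2 : D.conjTranspose = D := hD.1
    change M * M = M * D.conjTranspose at h1
    rw [h2] at h1
    rw [← h1]
    exact hMM
  have hM : M = M.conjTranspose * D⁻¹ * M := by
    have h1 : D⁻¹ * M = M * D⁻¹ := by
      calc D⁻¹ * M = D⁻¹ * (M * D) * D⁻¹ := by
            rw [mul_assoc, mul_assoc, Matrix.mul_nonsing_inv _ hDu, mul_one]
        _ = M * D⁻¹ := by
            rw [hMD, ← mul_assoc, Matrix.nonsing_inv_mul _ hDu, one_mul]
    rw [hMs, ← h1, mul_assoc, hMM]
    change M = D⁻¹ * (D * M)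
    rw [← mul_assoc, Matrix.nonsing_inv_mul _ hDu, one_mul]
  have hMpos : M.PosSemidef := by
    rw [hM]
    exact hD.inv.posSemidef.conjTranspose_mul_mul_same M
  have hfin := hMpos.dotProduct_mulVec_nonneg (fun p : I × I => c p.1 p.2)
  have e : star (fun p : I × I => c p.1 p.2) ⬝ᵥ (M.mulVec fun p : I × I => c p.1 p.2) =
      h (star (∑ i, ∑ j, c i j • v i j) * ∑ i, ∑ j, c i j • v i j) := by
    have e1 : ∑ i, ∑ j, c i j • v i j = ∑ p : I × I, c p.1 p.2 • v p.1 p.2 := by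
      rw [Fintype.sum_prod_type]
    rw [e1, star_sum, Finset.sum_mul_sum, map_sum]
    simp only [dotProduct, Matrix.mulVec, Finset.mul_sum, map_sum]
    refine Finset.sum_congr rfl fun p _ => Finset.sum_congr rfl fun r _ => ?_
    rw [star_smul, smul_mul_smul_comm, map_smul]
    simp only [Pi.star_apply, M, smul_eq_mul]
    ring
  rw [← e]
  exact hfin

/-- The direct sum of the corepresentations `u^{⊗n}`, `n < K`. -/
def sumRep (N K : ℕ) (i j : Σ n : Fin K, Fin n → Fin N) : Pol N :=
  Matrix.blockDiagonal' (fun n : Fin K => Matrix.of (genPow N n)) i j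

theorem sumRep_eq (N K : ℕ) (n : Fin K) (x y : Fin n → Fin N) :
    sumRep N K ⟨n, x⟩ ⟨n, y⟩ = genPow N n x y :=
  Matrix.blockDiagonal'_apply_eq _ _ _ _

theorem sumRep_ne (N K : ℕ) {m n : Fin K} (h : m ≠ n) (x : Fin m → Fin N) (y : Fin n → Fin N) :
    sumRep N K ⟨m, x⟩ ⟨n, y⟩ = 0 :=
  Matrix.blockDiagonal'_apply_ne _ _ _ h

theorem sumRep_row (N K : ℕ) (i j : Σ n : Fin K, Fin n → Fin N) :
    ∑ k, sumRep N K i k * star (sumRep N K j k) = if i = j then 1 else 0 := by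
  have h : Matrix.blockDiagonal' (fun n : Fin K => Matrix.of (genPow N n)) *
      (Matrix.blockDiagonal' fun n : Fin K => Matrix.of (genPow N n)).conjTranspose = 1 := by
    rw [Matrix.blockDiagonal'_conjTranspose, ← Matrix.blockDiagonal'_mul,
      ← Matrix.blockDiagonal'_one]
    congr 1
    funext n
    ext x y
    rw [Matrix.mul_apply, Pi.one_apply, Matrix.one_apply]
    exact genPow_row N n x y
  exact (congrArg (fun A => A i j) h).trans Matrix.one_apply

theorem sumRep_col (N K : ℕ) (i j : Σ n : Fin K, Fin n → Fin N) :
    ∑ k, star (sumRep N K k i) * sumRep N K k j = if i = j then 1 else 0 := by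
  have h : (Matrix.blockDiagonal' fun n : Fin K => Matrix.of (genPow N n)).conjTranspose *
      Matrix.blockDiagonal' (fun n : Fin K => Matrix.of (genPow N n)) = 1 := by
    rw [Matrix.blockDiagonal'_conjTranspose, ← Matrix.blockDiagonal'_mul,
      ← Matrix.blockDiagonal'_one]
    congr 1
    funext n
    ext x y
    rw [Matrix.mul_apply, Pi.one_apply, Matrix.one_apply]
    exact genPow_col N n x y
  exact (congrArg (fun A => A i j) h).trans Matrix.one_apply

theorem haarForm_star_mul (N m n : ℕ) (i j : Fin m → Fin N) (k l : Fin n → Fin N) :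
    haarForm N (star (genPow N m i j) * genPow N n k l) =
      fixMat N (m + n) (Fin.append (i ∘ Fin.rev) k) (Fin.append (j ∘ Fin.rev) l) := by
  rw [star_genPow, ← genPow_append, haarForm_genPow]

theorem sumRep_symm (N K : ℕ) (i j k l : Σ n : Fin K, Fin n → Fin N) :
    starRingEnd ℂ (haarForm N (star (sumRep N K i j) * sumRep N K k l)) =
      haarForm N (star (sumRep N K j i) * sumRep N K l k) := by
  obtain ⟨m, i⟩ := i
  obtain ⟨m', j⟩ := j
  obtain ⟨n, k⟩ := k
  obtain ⟨n', l⟩ := l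
  by_cases h : m = m'
  · subst h
    by_cases h : n = n'
    · subst h
      simp only [sumRep_eq, haarForm_star_mul, conj_fixMat]
    · simp [sumRep_ne N K h, sumRep_ne N K (Ne.symm h)]
  · simp [sumRep_ne N K h, sumRep_ne N K (Ne.symm h)]

theorem genPow_inv (N m n : ℕ) (i a : Fin m → Fin N) (k b : Fin n → Fin N) :
    ∑ j, ∑ l, haarForm N (star (genPow N m i j) * genPow N n k l) •
      (star (genPow N m j a) * genPow N n l b) =
      haarForm N (star (genPow N m i a) * genPow N n k b) • 1 := by
  simp only [haarForm_star_mul]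
  rw [← fixMat_fix', sum_append]
  let R : (Fin m → Fin N) ≃ (Fin m → Fin N) := Equiv.arrowCongr Fin.revPerm (Equiv.refl _)
  rw [← R.sum_comp]
  refine Finset.sum_congr rfl fun j _ => Finset.sum_congr rfl fun l _ => ?_
  have hR : R j = j ∘ Fin.rev := rfl
  have hRR : (j ∘ Fin.rev) ∘ Fin.rev = j := by
    funext k
    simp
  rw [star_genPow, ← genPow_append, hR, hRR]

theorem sumRep_sum (N K : ℕ) {A : Type} [AddCommMonoid A] (m : Fin K)
    (f : (Σ n : Fin K, Fin n → Fin N) → A) (hf : ∀ n, m ≠ n → ∀ x, f ⟨n, x⟩ = 0) :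
    ∑ j, f j = ∑ x, f ⟨m, x⟩ := by
  rw [Fintype.sum_sigma]
  refine Finset.sum_eq_single m (fun n _ hn => ?_) (fun h => absurd (Finset.mem_univ m) h)
  exact Finset.sum_eq_zero fun x _ => hf n (Ne.symm hn) x

theorem sumRep_inv (N K : ℕ) (i a k b : Σ n : Fin K, Fin n → Fin N) :
    ∑ j, ∑ l, haarForm N (star (sumRep N K i j) * sumRep N K k l) •
      (star (sumRep N K j a) * sumRep N K l b) =
      haarForm N (star (sumRep N K i a) * sumRep N K k b) • 1 := by
  obtain ⟨m, i⟩ := i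
  obtain ⟨m', a⟩ := a
  obtain ⟨n, k⟩ := k
  obtain ⟨n', b⟩ := b
  rw [sumRep_sum N K m _ fun n h x => by simp [sumRep_ne N K h]]
  have h1 : ∀ x : Fin m → Fin N, ∑ l, haarForm N (star (sumRep N K ⟨m, i⟩ ⟨m, x⟩) *
        sumRep N K ⟨n, k⟩ l) • (star (sumRep N K ⟨m, x⟩ ⟨m', a⟩) * sumRep N K l ⟨n', b⟩) =
      ∑ y, haarForm N (star (sumRep N K ⟨m, i⟩ ⟨m, x⟩) *
        sumRep N K ⟨n, k⟩ ⟨n, y⟩) •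
          (star (sumRep N K ⟨m, x⟩ ⟨m', a⟩) * sumRep N K ⟨n, y⟩ ⟨n', b⟩) := fun x =>
    sumRep_sum N K n _ fun n h x => by simp [sumRep_ne N K h]
  simp only [h1]
  by_cases h : m = m'
  · subst h
    by_cases h : n = n'
    · subst h
      simp only [sumRep_eq]
      exact genPow_inv N m n i a k b
    · simp [sumRep_ne N K h]
  · simp [sumRep_ne N K h]

theorem exists_sumRep (N : ℕ) (x : Pol N) :
    ∃ K₀ : ℕ, ∀ K, K₀ ≤ K → ∃ c : (Σ n : Fin K, Fin n → Fin N) →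
      (Σ n : Fin K, Fin n → Fin N) → ℂ, x = ∑ i, ∑ j, c i j • sumRep N K i j := by
  have hx : x ∈ Submodule.span ℂ {x : Pol N | ∃ n i j, x = genPow N n i j} := by
    rw [span_genPow]
    trivial
  induction hx using Submodule.span_induction with
  | zero => exact ⟨0, fun K _ => ⟨fun _ _ => 0, by simp⟩⟩
  | add a b _ _ ha hb =>
    obtain ⟨K₁, h₁⟩ := ha
    obtain ⟨K₂, h₂⟩ := hb
    refine ⟨max K₁ K₂, fun K hK => ?_⟩
    obtain ⟨c₁, e₁⟩ := h₁ K (le_trans (le_max_left _ _) hK)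
    obtain ⟨c₂, e₂⟩ := h₂ K (le_trans (le_max_right _ _) hK)
    refine ⟨fun i j => c₁ i j + c₂ i j, ?_⟩
    simp only [add_smul, Finset.sum_add_distrib]
    rw [← e₁, ← e₂]
  | smul r a _ ha =>
    obtain ⟨K₁, h₁⟩ := ha
    refine ⟨K₁, fun K hK => ?_⟩
    obtain ⟨c₁, e₁⟩ := h₁ K hK
    refine ⟨fun i j => r * c₁ i j, ?_⟩
    simp only [mul_smul, ← Finset.smul_sum]
    rw [← e₁]
  | mem a ha =>
    obtain ⟨n, x, y, rfl⟩ := ha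
    refine ⟨n + 1, fun K hK => ?_⟩
    let m : Fin K := ⟨n, hK⟩
    refine ⟨fun i j => if i = ⟨m, x⟩ then (if j = ⟨m, y⟩ then 1 else 0) else 0, ?_⟩
    dsimp only
    rw [Finset.sum_eq_single ⟨m, x⟩, Finset.sum_eq_single ⟨m, y⟩, if_pos rfl, if_pos rfl, one_smul,
      sumRep_eq]
    · intro j _ hj
      rw [if_pos rfl, if_neg hj, zero_smul]
    · exact fun h => absurd (Finset.mem_univ _) h
    · intro i _ hi
      simp only [if_neg hi, zero_smul, Finset.sum_const_zero]
    · exact fun h => absurd (Finset.mem_univ _) h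

theorem haarForm_nonneg (N : ℕ) (x : Pol N) : 0 ≤ haarForm N (star x * x) := by
  obtain ⟨K, hK⟩ := exists_sumRep N x
  obtain ⟨c, rfl⟩ := hK K le_rfl
  exact invariant_nonneg (haarForm N) (sumRep N K) (haarForm_star N) (haarForm_one N)
    (sumRep_row N K) (sumRep_col N K) (sumRep_inv N K) (sumRep_symm N K) c

/-- The Haar state of `𝔽O_N`. -/
def haar (N : ℕ) : HaarState N where
  form := haarForm N
  map_one := haarForm_one N
  nonneg := haarForm_nonneg N
  left_inv := haarForm_left N
  right_inv := haarForm_right N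

/-- The Haar state is unique. -/
theorem HaarState.form_eq {N : ℕ} (h : HaarState N) : h.form = haarForm N := by
  refine span_induction_genPow fun n x y => ?_
  have h1 := congrArg (haarForm N) (h.left_inv (genPow N n x y))
  have h2 := congrArg h.form (fixMat_fix N n x y)
  simp only [comul_genPow, map_sum, LinearMap.rTensor_tmul, TensorProduct.lid_tmul, map_smul,
    haarForm_genPow, haarForm_one, smul_eq_mul, mul_one] at h1
  simp only [map_sum, map_smul, h.map_one, smul_eq_mul, mul_one] at h2
  rw [← h1, haarForm_genPow, ← h2]
  exact Finset.sum_congr rfl fun z _ => mul_comm _ _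

/-! ### The Hilbert space `ℓ²(𝔽O_N)` and the subspace `H^{∘∘}` -/

/-- `Pol N` with the scalar product `(x | y) = h(x^* y)`. -/
def PreL2 {N : ℕ} (_ : HaarState N) : Type := Pol N

section PreL2

variable {N : ℕ} (h : HaarState N)

instance : AddCommGroup (PreL2 h) := inferInstanceAs (AddCommGroup (Pol N))

instance : Module ℂ (PreL2 h) := inferInstanceAs (Module ℂ (Pol N))

/-- The (possibly degenerate) scalar product `(x | y) = h(x^* y)`. -/
@[reducible] def preL2Core : PreInnerProductSpace.Core ℂ (PreL2 h) where
  inner (x y : Pol N) := h.form (star x * y)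
  conj_inner_symm (x y : Pol N) := by
    change starRingEnd ℂ (h.form (star y * x)) = h.form (star x * y)
    rw [← h.form_star, star_mul, star_star]
  re_inner_nonneg (x : Pol N) := (Complex.nonneg_iff.1 (h.nonneg x)).1
  add_left (x y z : Pol N) := by
    change h.form (star (x + y) * z) = h.form (star x * z) + h.form (star y * z)
    rw [star_add, add_mul, map_add]
  smul_left (x y : Pol N) (c : ℂ) := by
    change h.form (star (c • x) * y) = starRingEnd ℂ c * h.form (star x * y)
    rw [star_smul, smul_mul_assoc, map_smul]
    rfl

instance : SeminormedAddCommGroup (PreL2 h) :=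
  letI := preL2Core h
  InnerProductSpace.Core.toSeminormedAddCommGroup (𝕜 := ℂ)

instance : InnerProductSpace ℂ (PreL2 h) := InnerProductSpace.ofCore (preL2Core h)

theorem preL2_inner (x y : Pol N) :
    inner ℂ (E := PreL2 h) x y = h.form (star x * y) := rfl

/-- The Hilbert space `H = ℓ²(𝔽O_N)` of the GNS representation of `h`. -/
abbrev L2 : Type := UniformSpace.Completion (PreL2 h)

/-- The canonical map to the GNS space. -/
def toL2 : Pol N →ₗ[ℂ] L2 h :=
  (UniformSpace.Completion.toComplL (𝕜 := ℂ) (E := PreL2 h)).toLinearMap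

theorem inner_toL2 (x y : Pol N) : inner ℂ (toL2 h x) (toL2 h y) = h.form (star x * y) :=
  UniformSpace.Completion.inner_coe _ _

end PreL2

/-- The coefficient map `X ↦ u_n(X) = (id ⊗ Tr)(u_n (1 ⊗ X))`, where `u_n` is the restriction of
`u^{⊗n}` to `H_n`. -/
def coeff (N n : ℕ) : BH N n →ₗ[ℂ] Pol N where
  toFun X := ∑ i, ∑ j, extend N n X j i • genPow N n i j
  map_add' X Y := by
    simp [add_smul, Finset.sum_add_distrib]
  map_smul' c X := by
    simp [mul_smul, Finset.smul_sum]

section L2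

variable {N : ℕ} (h : HaarState N)

/-- The map `X ↦ u_n(X)` from `B(H_n)` to `H`. -/
def coeffL2 (n : ℕ) : BH N n →ₗ[ℂ] L2 h := toL2 h ∘ₗ coeff N n

/-- The subspace `p_n H = u_n(B(H_n))` of `H`. -/
def coeffSpace (n : ℕ) : Submodule ℂ (L2 h) := LinearMap.range (coeffL2 h n)

instance (n : ℕ) : FiniteDimensional ℂ (coeffSpace h n) :=
  inferInstanceAs (FiniteDimensional ℂ (LinearMap.range (coeffL2 h n)))

/-- The orthogonal projection `p_n` of `H` onto `u_n(B(H_n))`. -/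
def proj (n : ℕ) : L2 h →L[ℂ] L2 h := (coeffSpace h n).starProjection

/-- `H^{∘∘}`: the closed linear span of the subspaces `u_n(B(H_n)^{∘∘})`, `n ≥ 1`. -/
def HCirc : Submodule ℂ (L2 h) :=
  (⨆ n : ℕ, ⨆ _ : 1 ≤ n, (BCirc N n).map (coeffL2 h n)).topologicalClosure

/-- The subspace `p_n H^{∘∘}`. -/
def projHCirc (n : ℕ) : Submodule ℂ (L2 h) := (HCirc h).map (proj h n).toLinearMap

end L2

end FON

end

noncomputable section

namespace FON

/-! Reading the matrix of an operator on `H_n` as a tensor, with the column letters reversed,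
identifies `B(H_n)` with the tensors of length `2n` that are killed by every adjacent contraction
except possibly the one in the middle. The middle contraction is `id ⊗ Tr_1`, and the contraction of
the first letter with the last is `Tr_1 ⊗ id`. Hence `B(H_n)^{∘∘}` is the kernel, inside `H_{2n}`,
of the outer contraction, which takes its values in `H_{2n-2}` (`map_BCirc`). By rank-nullity the
formula for `n ≥ 2` says that the outer contraction maps `H_{2n}` onto `H_{2n-2}`. For `n = 1` the
outer contraction is `t^*` itself, already zero on `H_2`.

Surjectivity (`exists_harmonic_outer`) is explicit. Take vectors `y`, `z`, `w` with `y·y = z·z = 0`,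
`y·z = 1`, `w·w = 1` and `w` orthogonal to both, for the bilinear product; this is possible as `N ≥
3`. The tensor `w ⊗ f ⊗ w` has outer contraction `f` but is not harmonic. Terms with `y` at an end
letter repair this, since `y` pairs with `z` and not with itself. The choice of vectors makes the
outer contractions of all correction terms vanish as soon as `f` has a letter.

For `p_n H^{∘∘}` it is enough that `u_m` and `u_n` have orthogonal coefficients for `m ≠ n` and that
`X ↦ u_n(X)` is injective into `H`. Then `p_n H^{∘∘}` is the image of `B(H_n)^{∘∘}`. The Haar state
on `u^{⊗k}` is the projection onto the fixed vectors, and these are orthogonal to every tensor whose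
complete contractions vanish (`fixSpace_le_pairSpace`). A tensor of `H_m ⊗ H_n` has no complete
contraction other than the nested one, which exists only for `m = n` (`SplitHarmonic.mem_contrKer`).
This is Schur orthogonality: scalar products vanish for `m ≠ n`, and for `m = n` only a trace
survives. -/

/-- Functions on words in the letters `0, …, N - 1`. -/
abbrev WordFun (N : ℕ) : Type := List (Fin N) → ℂ

/-- The functions on words that vanish when two adjacent letters are contracted. -/
def Harmonic {N : ℕ} (f : WordFun N) : Prop :=
  ∀ p q : List (Fin N), ∑ a, f (p ++ a :: a :: q) = 0

/-- Contraction of the first letter with a vector. -/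
def lcon {N : ℕ} (v : Fin N → ℂ) (f : WordFun N) : WordFun N := fun l => ∑ a, v a * f (a :: l)

/-- Contraction of the last letter with a vector. -/
def rcon {N : ℕ} (v : Fin N → ℂ) (f : WordFun N) : WordFun N := fun l => ∑ a, v a * f (l ++ [a])

/-- Reversal of words. -/
def wrev {N : ℕ} (f : WordFun N) : WordFun N := fun l => f l.reverse

theorem wrev_wrev {N : ℕ} (f : WordFun N) : wrev (wrev f) = f := by
  funext l
  simp [wrev]

theorem wrev_rcon {N : ℕ} (v : Fin N → ℂ) (f : WordFun N) :
    wrev (rcon v f) = lcon v (wrev f) := by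
  funext l
  simp [wrev, rcon, lcon]

theorem lcon_rcon {N : ℕ} (v w : Fin N → ℂ) (f : WordFun N) :
    lcon v (rcon w f) = rcon w (lcon v f) := by
  funext l
  simp only [lcon, rcon, Finset.mul_sum, List.cons_append]
  rw [Finset.sum_comm]
  exact Finset.sum_congr rfl fun a _ => Finset.sum_congr rfl fun b _ => by ring

theorem rcon_zero {N : ℕ} (v : Fin N → ℂ) : rcon v (0 : WordFun N) = 0 := by
  funext l
  simp [rcon]

theorem rcon_neg {N : ℕ} (v : Fin N → ℂ) (f : WordFun N) : rcon v (-f) = -rcon v f := by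
  funext l
  simp [rcon]

theorem rcon_iterate_neg {N : ℕ} (v : Fin N → ℂ) (k : ℕ) (f : WordFun N) :
    (rcon v)^[k] (-f) = -(rcon v)^[k] f :=
  Function.Semiconj.iterate_right (f := Neg.neg) (fun g => (rcon_neg v g).symm) k f |>.symm

/-- At the empty word all letters are contracted with the same vector, so the end from which they
are taken is irrelevant. A right contraction can thus be traded for a left one, which
`lcon_extendLeft` computes. -/
theorem rcon_iterate_succ_nil {N : ℕ} (v : Fin N → ℂ) (k : ℕ) (f : WordFun N) :
    (rcon v)^[k + 1] f [] = (rcon v)^[k] (lcon v f) [] := by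
  have h : lcon v ((rcon v)^[k] f) = (rcon v)^[k] (lcon v f) :=
    Function.Semiconj.iterate_right (f := lcon v) (fun g => lcon_rcon v v g) k f
  rw [← h, Function.iterate_succ_apply']
  rfl

theorem Harmonic.wrev {N : ℕ} {f : WordFun N} (hf : Harmonic f) : Harmonic (wrev f) := by
  intro p q
  have h := hf q.reverse p.reverse
  simpa [FON.wrev] using h

theorem Harmonic.lcon {N : ℕ} {f : WordFun N} (hf : Harmonic f) (v : Fin N → ℂ) :
    Harmonic (lcon v f) := by
  intro p q
  simp only [FON.lcon]
  rw [Finset.sum_comm]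
  refine Finset.sum_eq_zero fun a _ => ?_
  rw [← Finset.mul_sum]
  have h := hf (a :: p) q
  simp only [List.cons_append] at h
  rw [h, mul_zero]

/-! ### Harmonic extension by one letter, and surjectivity of the outer contraction -/

/-- The harmonic extension `w ⊗ f - y ⊗ (z ⊗ f_w - y ⊗ ⋯)`, where `f_w` is the contraction of `f`
with `w`. -/
def extendLeft {N : ℕ} (y z : Fin N → ℂ) : (Fin N → ℂ) → WordFun N → WordFun N
  | _, _, [] => 0
  | w, f, a :: l => w a * f l - y a * extendLeft y z z (lcon w f) l

theorem lcon_extendLeft {N : ℕ} (y z w v : Fin N → ℂ) (f : WordFun N) :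
    lcon v (extendLeft y z w f) =
      (v ⬝ᵥ w) • f - (v ⬝ᵥ y) • extendLeft y z z (lcon w f) := by
  funext l
  simp only [lcon, extendLeft, Pi.sub_apply, Pi.smul_apply, smul_eq_mul, dotProduct,
    Finset.sum_mul, ← Finset.sum_sub_distrib]
  exact Finset.sum_congr rfl fun a _ => by ring

/-- Contracting the first two letters of `w ⊗ f` gives the contraction `f_w`. In the correction, `y`
meets the first letter of the extension of `f_w` by `z`, which also gives `f_w` because `y·z = 1`
and `y·y = 0`. Pairs further inside are handled by the harmonicity of `f` and by recursion. -/
theorem Harmonic.extendLeft {N : ℕ} {y z : Fin N → ℂ} (hyy : y ⬝ᵥ y = 0) (hyz : y ⬝ᵥ z = 1)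
    (w : Fin N → ℂ) {f : WordFun N} (hf : Harmonic f) : Harmonic (extendLeft y z w f) := by
  intro p q
  induction p generalizing w f with
  | nil =>
    have h := congrFun (lcon_extendLeft y z z y (FON.lcon w f)) q
    simp only [hyz, hyy, one_smul, zero_smul, sub_zero] at h
    change ∑ a, (w a * f (a :: q) - y a * FON.extendLeft y z z (FON.lcon w f) (a :: q)) = 0
    rw [Finset.sum_sub_distrib, sub_eq_zero]
    exact h.symm
  | cons b p ih =>
    simp only [List.cons_append, FON.extendLeft, Finset.sum_sub_distrib, ← Finset.mul_sum]
    rw [hf p q, ih z (hf.lcon w)]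
    simp

/-- The harmonic extension by a last letter. -/
def extendRight {N : ℕ} (y z w : Fin N → ℂ) (f : WordFun N) : WordFun N :=
  wrev (extendLeft y z w (wrev f))

theorem extendRight_append {N : ℕ} (y z w : Fin N → ℂ) (f : WordFun N) (l : List (Fin N))
    (a : Fin N) : extendRight y z w f (l ++ [a]) =
      w a * f l - y a * extendRight y z z (rcon w f) l := by
  simp only [extendRight, wrev_rcon]
  simp [wrev, extendLeft]

theorem extendRight_nil {N : ℕ} (y z w : Fin N → ℂ) (f : WordFun N) :
    extendRight y z w f [] = 0 := by
  simp [extendRight, wrev, extendLeft]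

/-- When the last letter is peeled off, the leading term dies by `hf` and the correction is the same
problem for `rcon z f`. The only obstruction is at the bottom: a one-letter extension is a scalar
times `z`, and `y` need not be orthogonal to `z`. That scalar is the complete contraction of `f`
with `z`, hence the hypothesis `hz`. -/
theorem lcon_extendRight_eq_zero {N : ℕ} {y z : Fin N → ℂ} (k : ℕ)
    {f : WordFun N} (hf : lcon y f = 0) (hz : (rcon z)^[k + 1] f [] = 0) (l : List (Fin N))
    (hl : l.length = k + 1) : lcon y (extendRight y z z f) l = 0 := by
  induction k generalizing f l with
  | zero =>
    obtain ⟨b, rfl⟩ := List.length_eq_one_iff.1 hl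
    have h1 : ∀ a, extendRight y z z f [a, b] =
        z b * f [a] - y b * (z a * rcon z f []) := by
      intro a
      have h := extendRight_append y z z f [a] b
      have h' := extendRight_append y z z (rcon z f) [] a
      rw [extendRight_nil, mul_zero, sub_zero] at h'
      simp only [List.nil_append] at h'
      rw [h'] at h
      exact h
    simp only [Function.iterate_succ, Function.iterate_zero, Function.comp_apply, id] at hz
    simp only [lcon, h1, hz, mul_zero, sub_zero]
    have h := congrFun hf []
    simp only [lcon, Pi.zero_apply] at h
    calc _ = z b * ∑ a, y a * f [a] := by
          rw [Finset.mul_sum]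
          exact Finset.sum_congr rfl fun a _ => by ring
      _ = 0 := by rw [h, mul_zero]
  | succ k ih =>
    obtain ⟨l, b, rfl⟩ : ∃ l' b, l = l' ++ [b] :=
      ⟨l.dropLast, l.getLast (by rintro rfl; simp at hl), (List.dropLast_append_getLast _).symm⟩
    have hl' : l.length = k + 1 := by simpa using hl
    have h1 := ih (f := rcon z f) (by rw [lcon_rcon, hf, rcon_zero])
      (by simpa only [Function.iterate_succ_apply] using hz) l hl'
    have h2 := congrFun hf l
    simp only [lcon, Pi.zero_apply] at h1 h2
    calc _ = z b * (∑ a, y a * f (a :: l)) -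
          y b * ∑ a, y a * extendRight y z z (rcon z f) (a :: l) := by
          simp only [lcon, Finset.mul_sum, ← Finset.sum_sub_distrib]
          refine Finset.sum_congr rfl fun a _ => ?_
          rw [← List.cons_append, extendRight_append]
          ring
      _ = 0 := by rw [h1, h2]; simp

/-- As `z·z = 0`, contracting the first letter with `z` only keeps the correction term, which is
minus an extension of the same kind, one letter shorter. At the end `z` alone remains, contracted
with the orthogonal vector `w`. -/
theorem rcon_iterate_extendLeft {N : ℕ} {y z w : Fin N → ℂ} (hzz : z ⬝ᵥ z = 0)
    (hyz : y ⬝ᵥ z = 1) (hwz : w ⬝ᵥ z = 0) (k : ℕ) (f : WordFun N) :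
    (rcon z)^[k] (rcon w (extendLeft y z z f)) [] = 0 := by
  induction k generalizing f with
  | zero =>
    simp only [Function.iterate_zero, id, rcon, List.nil_append, extendLeft, mul_zero, sub_zero]
    simp only [← mul_assoc, ← Finset.sum_mul]
    exact mul_eq_zero_of_left hwz _
  | succ k ih =>
    rw [rcon_iterate_succ_nil, lcon_rcon, lcon_extendLeft, hzz, dotProduct_comm z y, hyz,
      one_smul, zero_smul, zero_sub, rcon_neg, rcon_iterate_neg, Pi.neg_apply, ih, neg_zero]

/-- Contraction of the first and the last letter is onto. -/
theorem exists_harmonic_outer {N : ℕ} (hN : 3 ≤ N) {f : WordFun N} (hf : Harmonic f) :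
    ∃ g : WordFun N, Harmonic g ∧
      ∀ l : List (Fin N), l ≠ [] → ∑ a, g (a :: (l ++ [a])) = f l := by
  -- An isotropic pair `e_0 + i e_1`, `(e_0 - i e_1)/2` with bilinear product `1`, and the unit
  -- vector `e_2` orthogonal to both.
  let y : Fin N → ℂ := Pi.single ⟨0, by omega⟩ 1 + Pi.single ⟨1, by omega⟩ Complex.I
  let z : Fin N → ℂ := Pi.single ⟨0, by omega⟩ (1 / 2) - Pi.single ⟨1, by omega⟩ (Complex.I / 2)
  let w : Fin N → ℂ := Pi.single ⟨2, by omega⟩ 1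
  have hyy : y ⬝ᵥ y = 0 := by
    simp [y, dotProduct_add]
  have hyz : y ⬝ᵥ z = 1 := by
    simp [y, z, dotProduct_sub]
    linear_combination (-1 / 2 : ℂ) * Complex.I_mul_I
  have hzz : z ⬝ᵥ z = 0 := by
    simp [z, dotProduct_sub]
    linear_combination (1 / 4 : ℂ) * Complex.I_mul_I
  have hwz : w ⬝ᵥ z = 0 := by
    simp [w, z, dotProduct_sub]
  have hyw : y ⬝ᵥ w = 0 := by
    simp [w, y]
  have hww : w ⬝ᵥ w = 1 := by
    simp [w]
  -- The leading term on the right contributes the contraction of the left extension with `w`, which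
  -- is `f` since `w·w = 1` and `w·y = 0`. The correction on the right contributes a contraction
  -- with `y`, which `h3` shows to be zero; there `l` must be nonempty.
  refine ⟨extendRight y z w (extendLeft y z w f),
    ((hf.extendLeft hyy hyz w).wrev.extendLeft hyy hyz w).wrev, fun l hl => ?_⟩
  have h1 : lcon y (extendLeft y z w f) = 0 := by
    rw [lcon_extendLeft, hyw, hyy]
    simp
  have h2 : lcon w (extendLeft y z w f) = f := by
    rw [lcon_extendLeft, hww, dotProduct_comm, hyw]
    simp
  obtain ⟨k, hk⟩ : ∃ k, l.length = k + 1 :=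
    Nat.exists_eq_succ_of_ne_zero (by simpa using hl)
  have h3 := lcon_extendRight_eq_zero k (f := rcon w (extendLeft y z w f))
    (by rw [lcon_rcon, h1, rcon_zero])
    (by
      rw [rcon_iterate_succ_nil, lcon_rcon, lcon_extendLeft, dotProduct_comm z w, hwz,
        dotProduct_comm z y, hyz, one_smul, zero_smul, zero_sub, rcon_neg, rcon_iterate_neg,
        Pi.neg_apply, rcon_iterate_extendLeft hzz hyz hwz, neg_zero]) l hk
  have h4 := congrFun h2 l
  simp only [lcon] at h3 h4
  simp only [← List.cons_append, extendRight_append, Finset.sum_sub_distrib, h3, h4, sub_zero]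

/-! ### Vectors of `H_1^{⊗n}` as functions on words -/

/-- A vector of `H_1^{⊗n}` as a function on words, zero on the words whose length is not `n`. -/
def toWord {N n : ℕ} : TPow N n →ₗ[ℂ] WordFun N where
  toFun ζ l := if h : l.length = n then ζ (fun k => l.get (k.cast h.symm)) else 0
  map_add' ζ ξ := by
    funext l
    by_cases h : l.length = n <;> simp [h]
  map_smul' c ζ := by
    funext l
    by_cases h : l.length = n <;> simp [h]

theorem toWord_of_ne {N n : ℕ} (ζ : TPow N n) {l : List (Fin N)} (h : l.length ≠ n) :
    toWord ζ l = 0 :=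
  dif_neg h

theorem toWord_ofFn {N n : ℕ} (ζ : TPow N n) (x : Fin n → Fin N) :
    toWord ζ (List.ofFn x) = ζ x := by
  have h : (List.ofFn x).length = n := List.length_ofFn
  refine (dif_pos h).trans (congrArg ζ ?_)
  funext k
  simp

theorem exists_eq_ofFn {N n : ℕ} {l : List (Fin N)} (h : l.length = n) :
    ∃ x : Fin n → Fin N, l = List.ofFn x := by
  subst h
  exact ⟨l.get, (List.ofFn_get l).symm⟩

/-- The restriction of a function on words to the words of length `n`. -/
def ofWord {N : ℕ} (n : ℕ) (f : WordFun N) : TPow N n := WithLp.toLp 2 fun x => f (List.ofFn x)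

theorem toWord_ofWord {N n : ℕ} (f : WordFun N) {l : List (Fin N)} (h : l.length = n) :
    toWord (ofWord n f) l = f l := by
  obtain ⟨x, rfl⟩ := exists_eq_ofFn h
  rw [toWord_ofFn]
  rfl

theorem ofFn_insertNth {N n : ℕ} (i : Fin (n + 1)) (a : Fin N) (x : Fin n → Fin N) :
    List.ofFn (i.insertNth a x : Fin (n + 1) → Fin N) =
      (List.ofFn x).take i ++ a :: (List.ofFn x).drop i := by
  induction n with
  | zero =>
    obtain rfl : i = 0 := Fin.fin_one_eq_zero i
    rw [Fin.insertNth_zero', List.ofFn_cons]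
    simp
  | succ n ih =>
    refine Fin.cases ?_ (fun j => ?_) i
    · rw [Fin.insertNth_zero', List.ofFn_cons]
      simp
    · rw [← Fin.cons_self_tail x, Fin.insertNth_succ_cons, List.ofFn_cons, ih, List.ofFn_cons]
      simp

theorem toWord_contract {N m : ℕ} (i : Fin (m + 1)) (ζ : TPow N (m + 2)) {p q : List (Fin N)}
    (hp : p.length = i) (hl : (p ++ q).length = m) :
    toWord (contract N m i ζ) (p ++ q) = ∑ a, toWord ζ (p ++ a :: a :: q) := by
  obtain ⟨x, hx⟩ := exists_eq_ofFn hl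
  rw [hx, toWord_ofFn]
  change ∑ a : Fin N, ζ (i.castSucc.insertNth a (i.insertNth a x : Fin (m + 1) → Fin N)) = _
  refine Finset.sum_congr rfl fun a _ => ?_
  rw [← toWord_ofFn, ofFn_insertNth, ofFn_insertNth, ← hx, Fin.val_castSucc, ← hp]
  simp

/-- Words of the wrong length contribute zero, so one condition on words covers all `n`, including
`n < 2`, where there is nothing to contract. -/
theorem mem_HSpace_iff {N n : ℕ} (ζ : TPow N n) : ζ ∈ HSpace N n ↔ Harmonic (toWord ζ) := by
  have hshort : n < 2 → Harmonic (toWord ζ) := fun hn p q =>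
    Finset.sum_eq_zero fun a _ => toWord_of_ne ζ (by simp; omega)
  match n, ζ, hshort with
  | 0, ζ, hshort => exact ⟨fun _ => hshort (by norm_num), fun _ => Submodule.mem_top⟩
  | 1, ζ, hshort => exact ⟨fun _ => hshort (by norm_num), fun _ => Submodule.mem_top⟩
  | m + 2, ζ, _ =>
    simp only [HSpace, Submodule.mem_iInf, LinearMap.mem_ker]
    constructor
    · intro h p q
      by_cases hl : (p ++ q).length = m
      · have hp : p.length < m + 1 := by
          simp only [List.length_append] at hl
          omega
        rw [← toWord_contract ⟨p.length, hp⟩ ζ rfl hl, h, map_zero, Pi.zero_apply]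
      · refine Finset.sum_eq_zero fun a _ => toWord_of_ne ζ fun h' => hl ?_
        simp only [List.length_append, List.length_cons] at h' ⊢
        omega
    · intro h i
      ext x
      have hi : ((List.ofFn x).take i).length = i := by
        simp only [List.length_take, List.length_ofFn]
        omega
      have h' := toWord_contract i ζ (p := (List.ofFn x).take i) (q := (List.ofFn x).drop i) hi
        (by simp)
      rw [List.take_append_drop, toWord_ofFn, h] at h'
      exact h'

/-- Entrywise complex conjugation. -/
def conjVec {N n : ℕ} (ζ : TPow N n) : TPow N n := WithLp.toLp 2 fun x => starRingEnd ℂ (ζ x)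

theorem toWord_conjVec {N n : ℕ} (ζ : TPow N n) (l : List (Fin N)) :
    toWord (conjVec ζ) l = starRingEnd ℂ (toWord ζ l) := by
  by_cases h : l.length = n
  · obtain ⟨x, rfl⟩ := exists_eq_ofFn h
    rw [toWord_ofFn, toWord_ofFn]
    rfl
  · rw [toWord_of_ne _ h, toWord_of_ne _ h, map_zero]

theorem Harmonic.conj {N : ℕ} {f g : WordFun N} (hf : Harmonic f)
    (h : ∀ l, g l = starRingEnd ℂ (f l)) : Harmonic g := by
  intro p q
  simp only [h, ← map_sum, hf p q, map_zero]

/-- The coordinates of `t` are real. -/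
theorem conjVec_mem {N n : ℕ} {ζ : TPow N n} (h : ζ ∈ HSpace N n) : conjVec ζ ∈ HSpace N n := by
  rw [mem_HSpace_iff] at h ⊢
  exact h.conj (toWord_conjVec ζ)

/-! ### Operators on `H_n` as harmonic vectors -/

theorem extend_mul_sum {N n : ℕ} (X : BH N n) (c : TPow N n) (x : Fin n → Fin N) :
    ∑ y, extend N n X x y * c y =
      (X ((HSpace N n).orthogonalProjectionOnto c) : TPow N n) x := by
  have h : c = ∑ y, c y • EuclideanSpace.single y (1 : ℂ) := by
    ext z
    simp [Finset.sum_apply, Pi.single_apply]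
  conv_rhs => rw [h]
  simp only [map_sum, map_smul]
  simp [extend, mul_comm]

theorem extend_injective (N n : ℕ) : Function.Injective (extend N n) := by
  rw [← LinearMap.ker_eq_bot, LinearMap.ker_eq_bot']
  intro X hX
  refine LinearMap.ext fun v => Subtype.ext ?_
  ext x
  have h := extend_mul_sum X (v : TPow N n) x
  rw [hX, Submodule.orthogonalProjectionOnto_mem_subspace_eq_self] at h
  simpa using h.symm

/-- The columns express that the range lies in `H_n`. Vanishing on the orthogonal complement of
`H_n` says that the conjugates of the rows lie in `H_n`, and `H_n` is stable under conjugation. -/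
theorem exists_extend_iff {N n : ℕ} (M : TMat N n) : (∃ X, extend N n X = M) ↔
    (∀ y, WithLp.toLp 2 (fun x => M x y) ∈ HSpace N n) ∧
      ∀ x, WithLp.toLp 2 (M x) ∈ HSpace N n := by
  constructor
  · rintro ⟨X, rfl⟩
    refine ⟨fun y => (X _).2, fun x => ?_⟩
    have h : conjVec (WithLp.toLp 2 (extend N n X x)) ∈ HSpace N n := by
      refine (HSpace N n).orthogonal_orthogonal.le ((Submodule.mem_orthogonal _ _).2 fun c hc => ?_)
      have h := extend_mul_sum X c x
      rw [Submodule.orthogonalProjectionOnto_apply_of_mem_orthogonal hc, map_zero] at h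
      have h' := congrArg (starRingEnd ℂ) h
      simpa [PiLp.inner_apply, conjVec] using h'
    have h' := conjVec_mem h
    simpa [conjVec] using h'
  · rintro ⟨hcol, hrow⟩
    let X : BH N n :=
      { toFun := fun v => ⟨∑ y, (v : TPow N n) y • WithLp.toLp 2 (fun x => M x y),
          Submodule.sum_mem _ fun y _ => Submodule.smul_mem _ _ (hcol y)⟩
        map_add' := fun v w => Subtype.ext (by simp [add_smul, Finset.sum_add_distrib])
        map_smul' := fun c v => Subtype.ext (by simp [mul_smul, Finset.smul_sum]) }
    refine ⟨X, ?_⟩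
    ext x y
    have h := Submodule.starProjection_inner_eq_zero (EuclideanSpace.single y (1 : ℂ)) _
      (conjVec_mem (hrow x))
    rw [inner_sub_left, sub_eq_zero, EuclideanSpace.inner_single_left] at h
    have h' := congrArg (starRingEnd ℂ) h
    simp only [conjVec, map_mul, map_one, Complex.conj_conj, one_mul, PiLp.inner_apply,
      RCLike.inner_apply, map_sum] at h'
    rw [h']
    change (∑ z, _ • WithLp.toLp 2 (fun x => M x z) : TPow N n) x = _
    simp [mul_comm]

/-- The vector of `H_1^{⊗(n+n)}` given by a matrix; the indices of the columns are reversed. -/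
def vec (N n : ℕ) : TMat N n →ₗ[ℂ] TPow N (n + n) where
  toFun M := WithLp.toLp 2 fun z => M (z ∘ Fin.castAdd n) (z ∘ Fin.natAdd n ∘ Fin.rev)
  map_add' _ _ := rfl
  map_smul' _ _ := rfl

theorem vec_append {N n : ℕ} (M : TMat N n) (x y : Fin n → Fin N) :
    vec N n M (Fin.append x y) = M x (y ∘ Fin.rev) := by
  change M _ _ = _
  congr 1
  · funext k
    exact Fin.append_left _ _ _
  · funext k
    exact Fin.append_right _ _ _

theorem reverse_ofFn {N n : ℕ} (x : Fin n → Fin N) :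
    (List.ofFn x).reverse = List.ofFn (x ∘ Fin.rev) := by
  refine List.ext_get (by simp) fun k h1 h2 => ?_
  simp only [List.get_eq_getElem, List.getElem_reverse, List.getElem_ofFn, Function.comp_apply]
  congr 1
  ext
  simp [Fin.val_rev]
  omega

theorem toWord_vec {N n : ℕ} (M : TMat N n) (x y : Fin n → Fin N) :
    toWord (vec N n M) (List.ofFn x ++ (List.ofFn y).reverse) = M x y := by
  rw [reverse_ofFn, ← List.ofFn_fin_append, toWord_ofFn, vec_append]
  congr 1
  funext k
  simp

theorem vec_injective (N n : ℕ) : Function.Injective (vec N n) := by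
  intro M M' h
  ext x y
  rw [← toWord_vec M, h, toWord_vec]

/-- The functions on words that vanish when two adjacent letters are contracted, except possibly
the letters number `m` and `m + 1`. -/
def SplitHarmonic {N : ℕ} (m : ℕ) (f : WordFun N) : Prop :=
  ∀ p q : List (Fin N), p.length + 1 ≠ m → ∑ a, f (p ++ a :: a :: q) = 0

/-- A pair of adjacent letters that does not straddle the cut lies in one of the two halves, and the
letters of the other half are mere parameters. The condition thus describes `H_m ⊗ H_n`. -/
theorem splitHarmonic_iff {N m n : ℕ} {f : WordFun N} (hf : ∀ l, l.length ≠ m + n → f l = 0) :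
    SplitHarmonic m f ↔
      (∀ y : Fin n → Fin N, ofWord m (fun l => f (l ++ List.ofFn y)) ∈ HSpace N m) ∧
      ∀ x : Fin m → Fin N, ofWord n (fun l => f (List.ofFn x ++ l)) ∈ HSpace N n := by
  simp only [mem_HSpace_iff]
  constructor
  · refine fun h => ⟨fun y p q => ?_, fun x p q => ?_⟩
    · by_cases hl : p.length + q.length + 2 = m
      · calc _ = ∑ a, f (p ++ a :: a :: (q ++ List.ofFn y)) :=
              Finset.sum_congr rfl fun a _ => by
                rw [toWord_ofWord _ (by simp; omega)]
                simp
          _ = 0 := h _ _ (by omega)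
      · exact Finset.sum_eq_zero fun a _ => toWord_of_ne _ (by simp; omega)
    · by_cases hl : p.length + q.length + 2 = n
      · calc _ = ∑ a, f (List.ofFn x ++ p ++ a :: a :: q) :=
              Finset.sum_congr rfl fun a _ => by
                rw [toWord_ofWord _ (by simp; omega)]
                simp
          _ = 0 := h _ _ (by simp; omega)
      · exact Finset.sum_eq_zero fun a _ => toWord_of_ne _ (by simp; omega)
  · rintro ⟨hcol, hrow⟩ p q hp
    by_cases hl : p.length + q.length + 2 = m + n
    · by_cases hpm : p.length < m
      -- Here `p.length + 2 ≤ m`, because `p.length + 1 ≠ m`, so the subtraction is not truncated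
      -- and the contracted pair lies in the left half.
      · obtain ⟨y, hy⟩ := exists_eq_ofFn (n := n) (l := q.drop (m - p.length - 2))
          (by simp; omega)
        refine Eq.trans (Finset.sum_congr rfl fun a _ => ?_)
          (hcol y p (q.take (m - p.length - 2)))
        rw [toWord_ofWord _ (by simp; omega), ← hy]
        simp
      · obtain ⟨x, hx⟩ := exists_eq_ofFn (n := m) (l := p.take m) (by simp; omega)
        refine Eq.trans (Finset.sum_congr rfl fun a _ => ?_) (hrow x (p.drop m) q)
        rw [toWord_ofWord _ (by simp; omega), ← hx]
        simp [← List.append_assoc]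
    · exact Finset.sum_eq_zero fun a _ => hf _ (by simp; omega)

theorem harmonic_iff_splitHarmonic {N m n : ℕ} {f : WordFun N}
    (hf : ∀ l, l.length ≠ (m + 1) + (n + 1) → f l = 0) :
    Harmonic f ↔ SplitHarmonic (m + 1) f ∧ ∀ (x : Fin m → Fin N) (y : Fin n → Fin N),
      ∑ a, f (List.ofFn x ++ a :: a :: List.ofFn y) = 0 := by
  refine ⟨fun h => ⟨fun p q _ => h p q, fun x y => h _ _⟩, fun h p q => ?_⟩
  by_cases hp : p.length = m
  · by_cases hq : q.length = n
    · obtain ⟨x, rfl⟩ := exists_eq_ofFn hp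
      obtain ⟨y, rfl⟩ := exists_eq_ofFn hq
      exact h.2 x y
    · exact Finset.sum_eq_zero fun a _ => hf _ (by simp; omega)
  · exact h.1 p q (by omega)

theorem ofWord_mem_wrev {N n : ℕ} {f : WordFun N} (h : ofWord n f ∈ HSpace N n) :
    ofWord n (wrev f) ∈ HSpace N n := by
  rw [mem_HSpace_iff] at h ⊢
  have e : toWord (ofWord n (wrev f)) = wrev (toWord (ofWord n f)) := by
    funext l
    by_cases hl : l.length = n
    · rw [toWord_ofWord _ hl]
      exact (toWord_ofWord f (by simpa using hl)).symm
    · rw [toWord_of_ne _ hl]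
      exact (toWord_of_ne _ (by simpa using hl)).symm
  rw [e]
  exact h.wrev

/-- Reversing the column letters does no harm, since `H_n` is stable under reversal of words. -/
theorem exists_extend_iff_splitHarmonic {N n : ℕ} (M : TMat N n) :
    (∃ X, extend N n X = M) ↔ SplitHarmonic n (toWord (vec N n M)) := by
  rw [exists_extend_iff, splitHarmonic_iff fun l hl => toWord_of_ne _ hl]
  have hrev : ∀ y : Fin n → Fin N, (y ∘ Fin.rev) ∘ Fin.rev = y := fun y => by
    funext k
    simp
  have h1 : ∀ y : Fin n → Fin N,
      ofWord n (fun l => toWord (vec N n M) (l ++ List.ofFn (y ∘ Fin.rev))) =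
        WithLp.toLp 2 (fun x => M x y) := fun y => by
    ext x
    rw [← reverse_ofFn]
    exact toWord_vec M x y
  have h2 : ∀ x : Fin n → Fin N,
      ofWord n (wrev fun l => toWord (vec N n M) (List.ofFn x ++ l)) = WithLp.toLp 2 (M x) :=
    fun x => by
      ext y
      exact toWord_vec M x y
  simp only [← h1, ← h2]
  refine and_congr ⟨fun h y => ?_, fun h y => h _⟩
    ⟨fun h x => ?_, fun h x => ofWord_mem_wrev (h x)⟩
  · have h' := h (y ∘ Fin.rev)
    rwa [hrev] at h'
  · have h' := ofWord_mem_wrev (h x)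
    rwa [wrev_wrev] at h'

/-- Thanks to the reversal, the last row letter and the last column letter are neighbours in the
middle of the word. -/
theorem rightTrace_apply {N m : ℕ} (M : TMat N (m + 1)) (x y : Fin m → Fin N) :
    rightTrace N m M x y =
      ∑ a, toWord (vec N (m + 1) M) (List.ofFn x ++ a :: a :: List.ofFn (y ∘ Fin.rev)) := by
  change ∑ a : Fin N, M _ _ = _
  refine Finset.sum_congr rfl fun a _ => ?_
  rw [← toWord_vec M, List.ofFn_succ', List.ofFn_succ', ← reverse_ofFn]
  simp

/-- The first row letter and the first column letter end up at the two ends of the word. -/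
theorem leftTrace_apply {N m : ℕ} (M : TMat N (m + 1)) (x y : Fin m → Fin N) :
    leftTrace N m M x y = ∑ a, toWord (vec N (m + 1) M)
      (a :: ((List.ofFn x ++ List.ofFn (y ∘ Fin.rev)) ++ [a])) := by
  change ∑ a : Fin N, M _ _ = _
  refine Finset.sum_congr rfl fun a _ => ?_
  rw [← toWord_vec M, List.ofFn_cons, List.ofFn_cons, ← reverse_ofFn]
  simp

/-- The contraction of the first and the last letter, as a map `H_1^{⊗n} → H_1^{⊗k}`; it is zero
unless `n = k + 2`. -/
def outer (N n k : ℕ) : TPow N n →ₗ[ℂ] TPow N k where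
  toFun ζ := WithLp.toLp 2 fun x => ∑ a, toWord ζ (a :: (List.ofFn x ++ [a]))
  map_add' ζ ξ := by
    ext x
    simp [Finset.sum_add_distrib]
  map_smul' c ζ := by
    ext x
    simp [Finset.mul_sum]

/-- Membership in the range of `extend` gives all adjacent contractions except the middle one. The
right trace supplies the middle one, which completes `H_{2m+2}`, and the left trace is the outer
contraction. -/
theorem map_BCirc (N m : ℕ) :
    (BCirc N (m + 1)).map (vec N (m + 1) ∘ₗ extend N (m + 1)) =
      HSpace N (m + 1 + (m + 1)) ⊓ LinearMap.ker (outer N (m + 1 + (m + 1)) (m + m)) := by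
  have hrev : ∀ y : Fin m → Fin N, (y ∘ Fin.rev) ∘ Fin.rev = y := fun y => by
    funext k
    simp
  have hr : ∀ M : TMat N (m + 1), rightTrace N m M = 0 ↔
      ∀ (x y : Fin m → Fin N),
        ∑ a, toWord (vec N (m + 1) M) (List.ofFn x ++ a :: a :: List.ofFn y) = 0 := by
    intro M
    refine ⟨fun h x y => ?_, fun h => Matrix.ext fun x y => ?_⟩
    · rw [← hrev y, ← rightTrace_apply, h]
      rfl
    · rw [rightTrace_apply, h]
      rfl
  have hl : ∀ M : TMat N (m + 1), leftTrace N m M = 0 ↔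
      outer N (m + 1 + (m + 1)) (m + m) (vec N (m + 1) M) = 0 := by
    intro M
    refine ⟨fun h => ?_, fun h => Matrix.ext fun x y => ?_⟩
    · ext z
      obtain ⟨x, y, rfl⟩ := exists_append N m m z
      change ∑ a : Fin N, toWord _ _ = (0 : ℂ)
      rw [List.ofFn_fin_append]
      have h' := congrFun (congrFun h x) (y ∘ Fin.rev)
      rw [leftTrace_apply, hrev] at h'
      exact h'
    · rw [leftTrace_apply, ← List.ofFn_fin_append]
      exact congrArg (fun ζ : TPow N (m + m) => ζ (Fin.append x (y ∘ Fin.rev))) h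
  ext ζ
  simp only [Submodule.mem_map, Submodule.mem_inf, BCirc, LinearMap.mem_ker,
    LinearMap.comp_apply, hr, hl, mem_HSpace_iff]
  rw [harmonic_iff_splitHarmonic fun l h => toWord_of_ne ζ h]
  constructor
  · rintro ⟨X, ⟨h1, h2⟩, rfl⟩
    exact ⟨⟨(exists_extend_iff_splitHarmonic _).1 ⟨X, rfl⟩, h2⟩, h1⟩
  · rintro ⟨⟨h1, h2⟩, h3⟩
    let M : TMat N (m + 1) := fun x y => ζ (Fin.append x (y ∘ Fin.rev))
    have hM : vec N (m + 1) M = ζ := by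
      ext z
      obtain ⟨x, y, rfl⟩ := exists_append N (m + 1) (m + 1) z
      rw [vec_append]
      exact congrArg (fun y' => ζ (Fin.append x y')) (funext fun k => by simp)
    rw [← hM] at h1
    obtain ⟨X, hX⟩ := (exists_extend_iff_splitHarmonic M).2 h1
    refine ⟨X, ?_, by rw [hX, hM]⟩
    rw [hX, hM]
    exact ⟨h3, h2⟩

/-! ### The dimension of `B(H_n)^{∘∘}` -/

theorem finrank_BCirc (N m : ℕ) : Module.finrank ℂ (BCirc N (m + 1)) =
    Module.finrank ℂ ↥(HSpace N (m + 1 + (m + 1)) ⊓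
      LinearMap.ker (outer N (m + 1 + (m + 1)) (m + m))) := by
  rw [← map_BCirc]
  exact (Submodule.equivMapOfInjective _
    (show Function.Injective (vec N (m + 1) ∘ₗ extend N (m + 1)) from
      Function.Injective.comp (g := vec N (m + 1)) (vec_injective N (m + 1))
        (extend_injective N (m + 1))) _).finrank_eq

theorem toWord_outer {N n k : ℕ} (hn : n = k + 2) (ζ : TPow N n) (l : List (Fin N)) :
    toWord (outer N n k ζ) l = ∑ a, toWord ζ (a :: (l ++ [a])) := by
  by_cases hl : l.length = k
  · obtain ⟨x, rfl⟩ := exists_eq_ofFn hl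
    rw [toWord_ofFn]
    rfl
  · rw [toWord_of_ne _ hl]
    exact (Finset.sum_eq_zero fun a _ => toWord_of_ne _ (by simp; omega)).symm

/-- The outer contraction commutes with the inner ones, so it preserves harmonicity; the converse is
the construction by isotropic vectors. For `k = 0` the image is zero, because the outer pair is then
an adjacent pair. -/
theorem map_outer {N n k : ℕ} (hN : 3 ≤ N) (hn : n = k + 2) (hk : k ≠ 0) :
    (HSpace N n).map (outer N n k) = HSpace N k := by
  ext η
  rw [Submodule.mem_map]
  constructor
  · rintro ⟨ζ, hζ, rfl⟩
    rw [mem_HSpace_iff] at hζ ⊢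
    intro p q
    simp only [toWord_outer hn]
    rw [Finset.sum_comm]
    refine Finset.sum_eq_zero fun a _ => ?_
    have h := hζ (a :: p) (q ++ [a])
    simpa using h
  · intro hη
    obtain ⟨g, hg, hgη⟩ := exists_harmonic_outer hN ((mem_HSpace_iff η).1 hη)
    refine ⟨ofWord n g, ?_, ?_⟩
    · rw [mem_HSpace_iff]
      intro p q
      by_cases hl : p.length + q.length + 2 = n
      · rw [← hg p q]
        exact Finset.sum_congr rfl fun a _ => toWord_ofWord g (by simp; omega)
      · exact Finset.sum_eq_zero fun a _ => toWord_of_ne _ (by simp; omega)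
    · ext x
      have hx : List.ofFn x ≠ [] := by
        intro h
        have h' := congrArg List.length h
        simp at h'
        exact hk h'
      rw [← toWord_ofFn, ← toWord_ofFn η, toWord_outer hn, ← hgη _ hx]
      exact Finset.sum_congr rfl fun a _ => toWord_ofWord g (by simp; omega)

theorem finrank_BCirc_add {N n : ℕ} (hN : 3 ≤ N) (hn : 2 ≤ n) :
    Module.finrank ℂ (BCirc N n) + d N (2 * n - 2) = d N (2 * n) := by
  obtain ⟨m, rfl⟩ : ∃ m, n = m + 1 := ⟨n - 1, by omega⟩
  have e1 : 2 * (m + 1) - 2 = m + m := by omega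
  have e2 : 2 * (m + 1) = m + 1 + (m + 1) := by omega
  rw [finrank_BCirc, e1, e2]
  have h := LinearMap.finrank_range_add_finrank_ker
    ((outer N (m + 1 + (m + 1)) (m + m)).domRestrict (HSpace N (m + 1 + (m + 1))))
  rw [LinearMap.range_domRestrict, map_outer hN (by omega) (by omega), LinearMap.ker_domRestrict,
    add_comm] at h
  rw [d, d, ← h, ← Submodule.map_comap_subtype, Submodule.finrank_map_subtype_eq]

/-- With only two letters the outer contraction is the adjacent one, so the left trace adds no
condition. -/
theorem finrank_BCirc_one (N : ℕ) : Module.finrank ℂ (BCirc N 1) = d N 2 := by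
  rw [finrank_BCirc, inf_eq_left.2]
  · rfl
  · intro ζ hζ
    rw [mem_HSpace_iff] at hζ
    ext x
    have h := hζ [] []
    change ∑ a : Fin N, toWord ζ _ = (0 : ℂ)
    simpa using h

/-! ### Complete contractions -/

/-- Contraction of the letters at the places `p` and `p + 1`. -/
def wcon {N : ℕ} (p : ℕ) : WordFun N →ₗ[ℂ] WordFun N where
  toFun f l := ∑ a, f (l.take p ++ a :: a :: l.drop p)
  map_add' f g := by
    funext l
    simp [Finset.sum_add_distrib]
  map_smul' c f := by
    funext l
    simp [Finset.mul_sum]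

theorem wcon_append {N p : ℕ} (f : WordFun N) {u : List (Fin N)} (hu : u.length = p)
    (v : List (Fin N)) : wcon p f (u ++ v) = ∑ a, f (u ++ a :: a :: v) := by
  subst hu
  change ∑ a, f (_ ++ a :: a :: _) = _
  simp

/-- Insertion of `t` at the places `p` and `p + 1`. -/
def wins {N : ℕ} (p : ℕ) (f : WordFun N) : WordFun N := fun l =>
  if l[p]? = l[p + 1]? then f (l.take p ++ l.drop (p + 2)) else 0

theorem wins_append {N p : ℕ} (f : WordFun N) {u : List (Fin N)} (hu : u.length = p)
    (a b : Fin N) (v : List (Fin N)) :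
    wins p f (u ++ a :: b :: v) = if a = b then f (u ++ v) else 0 := by
  subst hu
  simp [wins]

/-- The functions on words whose contractions of `k` letters, two adjacent ones at a time, all
vanish. -/
def contrKer (N : ℕ) : ℕ → Submodule ℂ (WordFun N)
  | 0 => LinearMap.ker (LinearMap.proj (R := ℂ) (φ := fun _ : List (Fin N) => ℂ) [])
  | 1 => ⊤
  | k + 2 => ⨅ p : Fin (k + 1), (contrKer N k).comap (wcon p)

theorem mem_contrKer_add_two {N k n : ℕ} (hn : n = k + 2) {f : WordFun N} :
    f ∈ contrKer N n ↔ ∀ p ≤ k, wcon p f ∈ contrKer N k := by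
  subst hn
  simp only [contrKer, Submodule.mem_iInf, Submodule.mem_comap]
  exact ⟨fun h p hp => h ⟨p, Nat.lt_succ_of_le hp⟩, fun h p => h p (Nat.le_of_lt_succ p.2)⟩

theorem exists_append_length {N p : ℕ} {l : List (Fin N)} (h : p ≤ l.length) :
    ∃ u v, l = u ++ v ∧ u.length = p :=
  ⟨l.take p, l.drop p, (List.take_append_drop p l).symm, by simpa using h⟩

/-- Only words of length `k` matter. Identities that hold just for words long enough can therefore
be used inside `contrKer`. -/
theorem contrKer_congr {N k : ℕ} {f g : WordFun N} (hf : f ∈ contrKer N k)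
    (h : ∀ l : List (Fin N), l.length = k → g l = f l) : g ∈ contrKer N k := by
  induction k using Nat.strong_induction_on generalizing f g with
  | _ k ih =>
    match k, hf, ih, h with
    | 0, hf, _, h => exact (h [] rfl).trans hf
    | 1, _, _, _ => exact Submodule.mem_top
    | k + 2, hf, ih, h =>
      rw [mem_contrKer_add_two rfl] at hf ⊢
      refine fun p hp => ih k (by omega) (hf p hp) fun l hl => ?_
      obtain ⟨u, v, rfl, hu⟩ := exists_append_length (p := p) (l := l) (by omega)
      rw [wcon_append _ hu, wcon_append _ hu]
      refine Finset.sum_congr rfl fun a _ => h _ ?_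
      simp only [List.length_append, List.length_cons] at hl ⊢
      omega

theorem contrKer_of_eq_zero {N k : ℕ} {f : WordFun N}
    (h : ∀ l : List (Fin N), l.length = k → f l = 0) : f ∈ contrKer N k :=
  contrKer_congr (contrKer N k).zero_mem h

/-- A closed loop counts the letters. Together with the lemmas that follow, these are the
Temperley–Lieb relations between insertions and contractions. -/
theorem wcon_wins_same {N : ℕ} (p : ℕ) (f : WordFun N) {l : List (Fin N)} (hl : p ≤ l.length) :
    wcon p (wins p f) l = ((N : ℂ) • f) l := by
  obtain ⟨u, v, rfl, hu⟩ := exists_append_length hl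
  rw [wcon_append _ hu]
  simp [wins_append _ hu]

/-- The zigzag relation: the inserted pair and the contracted pair share one letter and straighten
to the identity. -/
theorem wcon_succ_wins {N : ℕ} (p : ℕ) (f : WordFun N) {l : List (Fin N)} (hl : p < l.length) :
    wcon (p + 1) (wins p f) l = f l := by
  obtain ⟨u, v, rfl, hu⟩ := exists_append_length hl.le
  match v, hl with
  | [], hl => simp [hu] at hl
  | b :: v, hl =>
    rw [← List.singleton_append, ← List.append_assoc, wcon_append _ (by simp [hu])]
    simp [wins_append _ hu]

theorem wcon_wins_succ {N : ℕ} (p : ℕ) (f : WordFun N) {l : List (Fin N)} (hl : p < l.length) :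
    wcon p (wins (p + 1) f) l = f l := by
  obtain ⟨u, v, rfl, hu⟩ := exists_append_length hl.le
  match v, hl with
  | [], hl => simp [hu] at hl
  | b :: v, hl =>
    rw [wcon_append _ hu]
    have h : ∀ a, wins (p + 1) f (u ++ a :: a :: b :: v) =
        if a = b then f (u ++ a :: v) else 0 := fun a => by
      rw [← List.singleton_append, ← List.append_assoc, wins_append _ (by simp [hu])]
      simp
    simp [h]

theorem wcon_wins_of_le {N : ℕ} {p r : ℕ} (h : p ≤ r) (f : WordFun N) {l : List (Fin N)}
    (hl : r + 2 ≤ l.length) : wcon p (wins (r + 2) f) l = wins r (wcon p f) l := by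
  obtain ⟨u, v, rfl, hu⟩ := exists_append_length (p := r) (l := l) (by omega)
  obtain ⟨u, u', rfl, hu'⟩ := exists_append_length (p := p) (l := u) (by omega)
  match v, hl with
  | [], hl => simp only [List.length_append, List.length_nil] at hl hu; omega
  | [b], hl => simp only [List.length_append, List.length_cons, List.length_nil] at hl hu; omega
  | b :: c :: v, hl =>
    rw [wins_append _ hu, List.append_assoc, wcon_append _ hu', List.append_assoc,
      wcon_append _ hu']
    have h : ∀ a, u ++ a :: a :: (u' ++ b :: c :: v) = (u ++ a :: a :: u') ++ b :: c :: v :=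
      fun a => by simp
    simp only [h]
    have h2 : ∀ a, (u ++ a :: a :: u').length = r + 2 := fun a => by
      simp only [List.length_append, List.length_cons] at hu ⊢
      omega
    simp only [wins_append f (h2 _)]
    split_ifs <;> simp

theorem wcon_wins_of_ge {N : ℕ} {p r : ℕ} (h : r ≤ p) (f : WordFun N) {l : List (Fin N)}
    (hl : p + 2 ≤ l.length) : wcon (p + 2) (wins r f) l = wins r (wcon p f) l := by
  obtain ⟨u, v, rfl, hu⟩ := exists_append_length (p := p + 2) (l := l) (by omega)
  obtain ⟨u, u', rfl, hu'⟩ := exists_append_length (p := r) (l := u) (by omega)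
  match u', hu with
  | [], hu => simp only [List.length_append, List.length_nil] at hu; omega
  | [b], hu => simp only [List.length_append, List.length_cons, List.length_nil] at hu; omega
  | b :: c :: u', hu =>
    rw [wcon_append _ hu]
    simp only [List.append_assoc, List.cons_append, wins_append _ hu']
    rw [← List.append_assoc, wcon_append _ (by
      simp only [List.length_append, List.length_cons] at hu ⊢
      omega)]
    split_ifs <;> simp

/-- The first contraction can meet the inserted pair in three ways. If the places coincide it
returns `N` times `f`; if they overlap in one letter it returns `f`; otherwise it commutes with the
insertion, and induction applies to the contraction of `f`. -/
theorem wins_mem_contrKer {N k p : ℕ} {f : WordFun N} (hp : p ≤ k) (hf : f ∈ contrKer N k) :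
    wins p f ∈ contrKer N (k + 2) := by
  induction k using Nat.strong_induction_on generalizing f p with
  | _ k ih =>
    rw [mem_contrKer_add_two rfl]
    intro r hr
    rcases lt_trichotomy r p with h | rfl | h
    · obtain ⟨s, rfl⟩ : ∃ s, p = s + 1 := ⟨p - 1, by omega⟩
      rcases Nat.lt_or_ge r s with h' | h'
      · obtain ⟨s, rfl⟩ : ∃ t, s = t + 1 := ⟨s - 1, by omega⟩
        obtain ⟨k, rfl⟩ : ∃ j, k = j + 2 := ⟨k - 2, by omega⟩
        rw [mem_contrKer_add_two rfl] at hf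
        exact contrKer_congr (ih k (by omega) (p := s) (by omega) (hf r (by omega)))
          fun l hl => wcon_wins_of_le (by omega) f (by omega)
      · obtain rfl : r = s := by omega
        exact contrKer_congr hf fun l hl => wcon_wins_succ r f (by omega)
    · exact contrKer_congr (Submodule.smul_mem _ _ hf) fun l hl => wcon_wins_same r f (by omega)
    · obtain ⟨s, rfl⟩ : ∃ s, r = s + 1 := ⟨r - 1, by omega⟩
      rcases Nat.lt_or_ge p s with h' | h'
      · obtain ⟨s, rfl⟩ : ∃ t, s = t + 1 := ⟨s - 1, by omega⟩
        obtain ⟨k, rfl⟩ : ∃ j, k = j + 2 := ⟨k - 2, by omega⟩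
        rw [mem_contrKer_add_two rfl] at hf
        exact contrKer_congr (ih k (by omega) (p := p) (by omega) (hf s (by omega)))
          fun l hl => wcon_wins_of_ge (by omega) f (by omega)
      · obtain rfl : p = s := by omega
        exact contrKer_congr hf fun l hl => wcon_succ_wins p f (by omega)

/-! ### The span of the pairings -/

/-- The space spanned by the vectors obtained from `1` by successive insertions of `t`. -/
def pairSpace (N n : ℕ) : Submodule ℂ (TPow N n) := ((contrKer N n).comap toWord)ᗮ

theorem ofFn_append_two {N p q : ℕ} (x : Fin p → Fin N) (a b : Fin N) (y : Fin q → Fin N) :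
    List.ofFn (Fin.append (Fin.append x ![a, b]) y) = List.ofFn x ++ a :: b :: List.ofFn y := by
  rw [List.ofFn_fin_append, List.ofFn_fin_append]
  simp

theorem toWord_conT {N p q : ℕ} (ζ : TPow N (p + 2 + q)) {l : List (Fin N)}
    (hl : l.length = p + q) : toWord (conT N p q ζ) l = wcon p (toWord ζ) l := by
  obtain ⟨z, rfl⟩ := exists_eq_ofFn hl
  obtain ⟨x, y, rfl⟩ := exists_append N p q z
  rw [toWord_ofFn, conT_apply, List.ofFn_fin_append, wcon_append _ List.length_ofFn]
  refine Finset.sum_congr rfl fun a _ => ?_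
  rw [← ofFn_append_two, toWord_ofFn]

theorem toWord_insT {N p q : ℕ} (η : TPow N (p + q)) {l : List (Fin N)}
    (hl : l.length = p + 2 + q) : toWord (insT N p q η) l = wins p (toWord η) l := by
  obtain ⟨z, rfl⟩ := exists_eq_ofFn hl
  obtain ⟨x, a, b, y, rfl⟩ := exists_split N p q z
  rw [toWord_ofFn, insT_apply, ofFn_append_two, wins_append _ List.length_ofFn,
    ← List.ofFn_fin_append, toWord_ofFn]

/-- Insertion is adjoint to contraction, and `contrKer` is by definition stable under contraction.
-/
theorem insT_mem_pairSpace (N p q : ℕ) {η : TPow N (p + q)} (hη : η ∈ pairSpace N (p + q)) :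
    insT N p q η ∈ pairSpace N (p + 2 + q) := by
  refine (Submodule.mem_orthogonal _ _).2 fun ζ hζ => ?_
  rw [inner_insT]
  refine (Submodule.mem_orthogonal _ _).1 hη _ ?_
  rw [Submodule.mem_comap, mem_contrKer_add_two (k := p + q) (by omega)] at hζ
  exact contrKer_congr (hζ p (by omega)) fun l hl => toWord_conT ζ hl

/-- By the same adjunction, this is the stability of `contrKer` under insertion, that is, the
Temperley–Lieb relations. -/
theorem conT_mem_pairSpace (N p q : ℕ) {ζ : TPow N (p + 2 + q)}
    (hζ : ζ ∈ pairSpace N (p + 2 + q)) : conT N p q ζ ∈ pairSpace N (p + q) := by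
  refine (Submodule.mem_orthogonal' _ _).2 fun η hη => ?_
  rw [← inner_insT]
  refine (Submodule.mem_orthogonal' _ _).1 hζ _ ?_
  have h := wins_mem_contrKer (p := p) (by omega) (Submodule.mem_comap.1 hη)
  rw [show p + q + 2 = p + 2 + q by omega] at h
  exact contrKer_congr h fun l hl => toWord_insT η hl

theorem pairSpace_zero (N : ℕ) : pairSpace N 0 = ⊤ := by
  rw [pairSpace, Submodule.orthogonal_eq_top_iff, eq_bot_iff]
  intro ζ hζ
  rw [Submodule.mem_bot]
  ext x
  rw [← toWord_ofFn]
  simpa [contrKer] using hζ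

/-! ### The fixed vectors are spanned by pairings -/

section ProjMat

variable {N : ℕ} (S : ∀ n, Submodule ℂ (TPow N n))

/-- The matrices of the orthogonal projections onto a family of subspaces. -/
def projMat (n : ℕ) (x y : Fin n → Fin N) : ℂ := (S n).starProjection (EuclideanSpace.single y 1) x

theorem conj_projMat (n : ℕ) (x y : Fin n → Fin N) :
    starRingEnd ℂ (projMat S n x y) = projMat S n y x := by
  have h := (S n).inner_starProjection_left_eq_right
    (EuclideanSpace.single y 1) (EuclideanSpace.single x 1)
  rw [EuclideanSpace.inner_single_right, EuclideanSpace.inner_single_left] at h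
  simpa [projMat] using h

theorem sum_projMat (n : ℕ) (ξ : TPow N n) (x : Fin n → Fin N) :
    ∑ y, projMat S n x y * ξ y = (S n).starProjection ξ x := by
  have h : ξ = ∑ y, ξ y • EuclideanSpace.single y (1 : ℂ) := by
    ext z
    simp [Finset.sum_apply, Pi.single_apply]
  conv_rhs => rw [h]
  rw [map_sum]
  simp [projMat, mul_comm]

/-- Stability under insertions and under their adjoints makes the projections commute with the
insertion of `t`. -/
theorem projMat_row
    (hins : ∀ p q η, η ∈ S (p + q) → insT N p q η ∈ S (p + 2 + q))
    (hcon : ∀ p q ζ, ζ ∈ S (p + 2 + q) → conT N p q ζ ∈ S (p + q))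
    (p q : ℕ) (x x' : Fin p → Fin N) (y y' : Fin q → Fin N) (a b : Fin N) :
    ∑ c, projMat S (p + 2 + q) (Fin.append (Fin.append x ![a, b]) y)
      (Fin.append (Fin.append x' ![c, c]) y') =
      if a = b then projMat S (p + q) (Fin.append x y) (Fin.append x' y') else 0 := by
  have h : insT N p q ((S (p + q)).starProjection
        (EuclideanSpace.single (Fin.append x' y') 1)) = (S (p + 2 + q)).starProjection
        (insT N p q (EuclideanSpace.single (Fin.append x' y') 1)) := by
    refine Submodule.eq_starProjection_of_mem_of_inner_eq_zero
      (hins p q _ (Submodule.starProjection_apply_mem _ _)) ?_ |>.symm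
    intro ζ hζ
    rw [← insT_sub, ← inner_conj_symm, inner_insT, ← inner_conj_symm (conT N p q ζ),
      Submodule.starProjection_inner_eq_zero _ _ (hcon p q _ hζ)]
    simp
  have h' := insT_apply N p q ((S (p + q)).starProjection
        (EuclideanSpace.single (Fin.append x' y') 1)) x y a b
  rw [h, insT_single, map_sum] at h'
  simpa [projMat] using h'

theorem projMat_col
    (hins : ∀ p q η, η ∈ S (p + q) → insT N p q η ∈ S (p + 2 + q))
    (hcon : ∀ p q ζ, ζ ∈ S (p + 2 + q) → conT N p q ζ ∈ S (p + q))
    (p q : ℕ) (x x' : Fin p → Fin N) (y y' : Fin q → Fin N) (a b : Fin N) :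
    ∑ c, projMat S (p + 2 + q) (Fin.append (Fin.append x ![c, c]) y)
      (Fin.append (Fin.append x' ![a, b]) y') =
      if a = b then projMat S (p + q) (Fin.append x y) (Fin.append x' y') else 0 := by
  have h := congrArg (starRingEnd ℂ) (projMat_row S hins hcon p q x' x y' y a b)
  rw [map_sum] at h
  simpa only [conj_projMat, apply_ite (starRingEnd ℂ), map_zero] using h

/-- The entries of the projections, as a function on words. -/
def projFun (w : List (Fin N × Fin N)) : ℂ :=
  let s := List.equivSigmaTuple w
  projMat S s.1 (fun k => (s.2 k).1) (fun k => (s.2 k).2)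

theorem projFun_ofFn (n : ℕ) (x y : Fin n → Fin N) :
    projFun S (List.ofFn fun k => (x k, y k)) = projMat S n x y := by
  have h : List.equivSigmaTuple (List.ofFn fun k => (x k, y k)) = ⟨n, fun k => (x k, y k)⟩ :=
    List.equivSigmaTuple.apply_symm_apply ⟨n, fun k => (x k, y k)⟩
  unfold projFun
  rw [h]

theorem ofFn_prod_append {p q : ℕ} (x x' : Fin p → Fin N) (y y' : Fin q → Fin N) :
    (List.ofFn fun k => (Fin.append x y k, Fin.append x' y' k)) =
      (List.ofFn fun k => (x k, x' k)) ++ List.ofFn fun k => (y k, y' k) := by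
  rw [← List.ofFn_fin_append]
  congr 1
  funext k
  refine Fin.addCases (fun k => ?_) (fun k => ?_) k <;> simp

theorem projFun_append {p q : ℕ} (x x' : Fin p → Fin N) (y y' : Fin q → Fin N) :
    projFun S ((List.ofFn fun k => (x k, x' k)) ++ List.ofFn fun k => (y k, y' k)) =
      projMat S (p + q) (Fin.append x y) (Fin.append x' y') := by
  rw [← ofFn_prod_append, projFun_ofFn]

theorem projFun_split {p q : ℕ} (x x' : Fin p → Fin N) (y y' : Fin q → Fin N)
    (a b c e : Fin N) :
    projFun S ((List.ofFn fun k => (x k, x' k)) ++ (a, c) :: (b, e) ::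
      List.ofFn fun k => (y k, y' k)) =
      projMat S (p + 2 + q) (Fin.append (Fin.append x ![a, b]) y)
        (Fin.append (Fin.append x' ![c, e]) y') := by
  rw [← projFun_append, ofFn_prod_append]
  simp

theorem projFun_mem
    (hins : ∀ p q η, η ∈ S (p + q) → insT N p q η ∈ S (p + 2 + q))
    (hcon : ∀ p q ζ, ζ ∈ S (p + 2 + q) → conT N p q ζ ∈ S (p + q))
    : projFun S ∈ relMod N := by
  intro w w' i j
  have hw : ∀ w : List (Fin N × Fin N), ∃ n, ∃ x y : Fin n → Fin N,
      w = List.ofFn fun k => (x k, y k) := fun w =>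
    ⟨w.length, fun k => (w.get k).1, fun k => (w.get k).2, (List.ofFn_get w).symm⟩
  obtain ⟨p, x, x', rfl⟩ := hw w
  obtain ⟨q, y, y', rfl⟩ := hw w'
  simp only [projFun_split, projFun_append]
  exact ⟨projMat_row S hins hcon p q x x' y y' i j, projMat_col S hins hcon p q x x' y y' i j⟩

/-- A family of subspaces that contains the scalars and is stable under insertions and
contractions contains the fixed vectors. -/
theorem fixSpace_le (h0 : S 0 = ⊤)
    (hins : ∀ p q η, η ∈ S (p + q) → insT N p q η ∈ S (p + 2 + q))
    (hcon : ∀ p q ζ, ζ ∈ S (p + 2 + q) → conT N p q ζ ∈ S (p + q))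
    (n : ℕ) : fixSpace N n ≤ S n := by
  -- The projections onto the `S n` satisfy the relations of `Pol N`, hence define a linear form
  -- whose matrix of values on `u^{⊗n}` is the projection onto `S n`. Applied to the equations
  -- saying that `ξ` is fixed, this form gives that the projection of `ξ` is `ξ`.
  let form : Pol N → ℂ := fun x => (wordRep N x ⟨projFun S, projFun_mem S hins hcon⟩).1 []
  have hform : ∀ n x y, form (genPow N n x y) = projMat S n x y := fun n x y => by
    change (wordRep N (genPow N n x y) _).1 [] = _
    rw [wordRep_genPow, List.nil_append]
    exact projFun_ofFn S n x y
  let formL : Pol N →ₗ[ℂ] ℂ :=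
    { toFun := form
      map_add' := fun x y => by simp only [form, map_add]; rfl
      map_smul' := fun c x => by simp only [form, map_smul]; rfl }
  have hone : formL 1 = 1 := by
    have h1 : genPow N 0 Fin.elim0 Fin.elim0 = 1 := by simp [genPow]
    rw [← h1]
    refine (hform _ _ _).trans ?_
    rw [projMat, Submodule.starProjection_eq_self_iff.2 (by rw [h0]; exact Submodule.mem_top)]
    change (Pi.single Fin.elim0 1 : (Fin 0 → Fin N) → ℂ) Fin.elim0 = 1
    exact Pi.single_eq_same _ _
  intro ξ hξ
  rw [← Submodule.starProjection_eq_self_iff]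
  ext x
  have h := congrArg formL (hξ x)
  rw [map_sum, map_smul, hone, smul_eq_mul, mul_one] at h
  rw [← h, ← sum_projMat]
  refine Finset.sum_congr rfl fun y _ => ?_
  rw [map_smul, smul_eq_mul, mul_comm]
  exact congrArg (ξ y * ·) (hform n x y).symm

end ProjMat

theorem fixSpace_le_pairSpace (N n : ℕ) : fixSpace N n ≤ pairSpace N n :=
  fixSpace_le (pairSpace N) (pairSpace_zero N) (fun p q _ h => insT_mem_pairSpace N p q h)
    (fun p q _ h => conT_mem_pairSpace N p q h) n

theorem starProjection_fixSpace_eq_zero {N n : ℕ} {ζ : TPow N n}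
    (h : toWord ζ ∈ contrKer N n) : (fixSpace N n).starProjection ζ = 0 := by
  rw [Submodule.starProjection_apply_eq_zero_iff]
  refine (Submodule.mem_orthogonal' _ _).2 fun ξ hξ => ?_
  exact (Submodule.mem_orthogonal _ _).1 (fixSpace_le_pairSpace N n hξ) ζ h

/-! ### Contraction of `H_m ⊗ H_n` -/

/-- The complete nested contraction of the words of length `n + n`. -/
def nested {N : ℕ} (n : ℕ) (f : WordFun N) : ℂ :=
  ∑ x : Fin n → Fin N, f ((List.ofFn x).reverse ++ List.ofFn x)

/-- The innermost pair of the nested contraction sits at the places `n` and `n + 1`; `wcon n`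
removes it. -/
theorem nested_succ {N : ℕ} (n : ℕ) (f : WordFun N) :
    nested (n + 1) f = nested n (wcon n f) := by
  unfold nested
  rw [← (Fin.consEquiv fun _ : Fin (n + 1) => Fin N).sum_comp, Fintype.sum_prod_type,
    Finset.sum_comm]
  refine Finset.sum_congr rfl fun x _ => ?_
  rw [wcon_append _ (by simp)]
  refine Finset.sum_congr rfl fun a _ => ?_
  change f ((List.ofFn (Fin.cons a x : Fin (n + 1) → Fin N)).reverse ++
    List.ofFn (Fin.cons a x : Fin (n + 1) → Fin N)) = _
  rw [List.ofFn_cons]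
  simp

/-- Contractions of disjoint pairs commute. A pair that does not straddle the new cut comes from a
pair that did not straddle the old one. -/
theorem SplitHarmonic.wcon {N m : ℕ} {f : WordFun N} (hf : SplitHarmonic (m + 1) f) :
    SplitHarmonic m (wcon m f) := by
  intro p q hp
  rcases Nat.lt_or_ge p.length m with h | h
  · by_cases hq : m ≤ (p ++ q).length + 2
    · obtain ⟨u, v, hv, hu⟩ := exists_append_length (p := m - p.length - 2) (l := q) (by
        simp only [List.length_append] at hq
        omega)
      subst hv
      have h1 : ∀ a : Fin N, FON.wcon m f (p ++ a :: a :: (u ++ v)) =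
          ∑ b, f (p ++ a :: a :: (u ++ b :: b :: v)) := fun a => by
        have e : p ++ a :: a :: (u ++ v) = (p ++ a :: a :: u) ++ v := by simp
        rw [e, wcon_append _ (by
          simp only [List.length_append, List.length_cons] at hq ⊢
          omega)]
        simp
      simp only [h1]
      rw [Finset.sum_comm]
      exact Finset.sum_eq_zero fun b _ => hf p _ (by omega)
    -- On a word of length at most `m`, `wcon m` contracts a pair appended at the end. Such words
    -- play no role later, but the condition must hold for them too.
    · have h1 : ∀ a : Fin N, FON.wcon m f (p ++ a :: a :: q) =
          ∑ b, f (p ++ a :: a :: (q ++ [b, b])) := fun a => by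
        have hl : (p ++ a :: a :: q).length ≤ m := by
          simp only [List.length_append, List.length_cons] at hq ⊢
          omega
        change ∑ b, f (_ ++ b :: b :: _) = _
        rw [List.take_of_length_le hl, List.drop_of_length_le hl]
        simp
      simp only [h1]
      rw [Finset.sum_comm]
      exact Finset.sum_eq_zero fun b _ => hf p _ (by omega)
  · obtain ⟨u, v, hv, hu⟩ := exists_append_length (p := m) (l := p) h
    subst hv
    simp only [List.append_assoc, wcon_append f hu]
    rw [Finset.sum_comm]
    refine Finset.sum_eq_zero fun b _ => ?_
    have h2 := hf (u ++ b :: b :: v) q (by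
      simp only [List.length_append, List.length_cons]
      omega)
    simpa using h2

/-- A vector of `H_m ⊗ H_n` is orthogonal to all pairings if `m ≠ n` or if its complete nested
contraction vanishes. -/
theorem SplitHarmonic.mem_contrKer {N m n : ℕ} {f : WordFun N} (hf : SplitHarmonic m f)
    (h : m = n → nested n f = 0) : f ∈ contrKer N (m + n) := by
  have hmain : ∀ k m n f, m + n = k → SplitHarmonic m f → (m = n → nested n f = 0) →
      f ∈ contrKer N k := by
    clear hf h f m n
    intro k
    induction k using Nat.strong_induction_on with
    | _ k ih =>
      intro m n f hk hf h
      match k, hk, ih with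
      | 0, hk, _ =>
        obtain rfl : m = 0 := by omega
        obtain rfl : n = 0 := by omega
        have h0 : f [] = 0 := by simpa [nested] using h rfl
        exact h0
      | 1, _, _ => exact Submodule.mem_top
      | k + 2, hk, ih =>
        rw [mem_contrKer_add_two rfl]
        intro p hp
        -- The contraction across the cut is the only one that need not vanish. It shortens both
        -- sides by one letter; `n` is positive since `p ≤ k`. If `m ≠ n`, one side is exhausted
        -- while letters remain, and then every contraction vanishes.
        by_cases hpm : p + 1 = m
        · subst hpm
          obtain ⟨n, rfl⟩ : ∃ j, n = j + 1 := ⟨n - 1, by omega⟩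
          refine ih k (by omega) p n _ (by omega) hf.wcon fun e => ?_
          subst e
          rw [← nested_succ]
          exact h rfl
        · refine contrKer_of_eq_zero fun l hl => ?_
          obtain ⟨u, v, rfl, hu⟩ := exists_append_length (p := p) (l := l) (by omega)
          rw [wcon_append f hu]
          exact hf u v (by omega)
  exact hmain _ m n f rfl hf h

/-! ### Orthogonality of coefficients -/

/-- The vector of `H_1^{⊗(m+n)}` given by a matrix; the indices of the rows are reversed. -/
def rowVec {N m n : ℕ} (A : Matrix (Fin m → Fin N) (Fin n → Fin N) ℂ) : TPow N (m + n) :=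
  WithLp.toLp 2 fun z => A (z ∘ Fin.castAdd n ∘ Fin.rev) (z ∘ Fin.natAdd m)

theorem comp_rev_rev {N n : ℕ} (x : Fin n → Fin N) : (x ∘ Fin.rev) ∘ Fin.rev = x := by
  funext k
  simp

theorem rowVec_append {N m n : ℕ} (A : Matrix (Fin m → Fin N) (Fin n → Fin N) ℂ)
    (x : Fin m → Fin N) (y : Fin n → Fin N) :
    rowVec A (Fin.append (x ∘ Fin.rev) y) = A x y := by
  change A _ _ = _
  congr 1
  · funext k
    refine (Fin.append_left _ _ _).trans ?_
    simp
  · funext k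
    exact Fin.append_right _ _ _

theorem toWord_rowVec {N m n : ℕ} (A : Matrix (Fin m → Fin N) (Fin n → Fin N) ℂ)
    (x : Fin m → Fin N) (y : Fin n → Fin N) :
    toWord (rowVec A) ((List.ofFn x).reverse ++ List.ofFn y) = A x y := by
  rw [reverse_ofFn, ← List.ofFn_fin_append, toWord_ofFn, rowVec_append]

theorem sum_rowVec {N m n : ℕ} {B : Type} [AddCommMonoid B] (f : (Fin (m + n) → Fin N) → B) :
    ∑ z, f z = ∑ x : Fin m → Fin N, ∑ y : Fin n → Fin N, f (Fin.append (x ∘ Fin.rev) y) := by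
  let R : (Fin m → Fin N) ≃ (Fin m → Fin N) := Equiv.arrowCongr Fin.revPerm (Equiv.refl _)
  rw [sum_append, ← R.sum_comp]
  rfl

theorem nested_rowVec {N n : ℕ} (A : Matrix (Fin n → Fin N) (Fin n → Fin N) ℂ) :
    nested n (toWord (rowVec A)) = A.trace :=
  Finset.sum_congr rfl fun x _ => toWord_rowVec A x x

/-- The matrices whose rows and columns are harmonic. -/
def harmonicMat (N m n : ℕ) : Submodule ℂ (Matrix (Fin m → Fin N) (Fin n → Fin N) ℂ) where
  carrier := {A | (∀ y, WithLp.toLp 2 (fun x => A x y) ∈ HSpace N m) ∧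
    ∀ x, WithLp.toLp 2 (A x) ∈ HSpace N n}
  add_mem' hA hB := ⟨fun y => Submodule.add_mem _ (hA.1 y) (hB.1 y),
    fun x => Submodule.add_mem _ (hA.2 x) (hB.2 x)⟩
  zero_mem' := ⟨fun _ => Submodule.zero_mem _, fun _ => Submodule.zero_mem _⟩
  smul_mem' c _ hA := ⟨fun y => Submodule.smul_mem _ c (hA.1 y),
    fun x => Submodule.smul_mem _ c (hA.2 x)⟩

theorem splitHarmonic_rowVec {N m n : ℕ} {A : Matrix (Fin m → Fin N) (Fin n → Fin N) ℂ}
    (hA : A ∈ harmonicMat N m n) : SplitHarmonic m (toWord (rowVec A)) := by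
  rw [splitHarmonic_iff fun l hl => toWord_of_ne _ hl]
  refine ⟨fun y => ?_, fun x => ?_⟩
  · have h : ofWord m (wrev fun l => toWord (rowVec A) (l ++ List.ofFn y)) =
        WithLp.toLp 2 (fun x => A x y) := by
      ext x
      exact toWord_rowVec A x y
    have h' := hA.1 y
    rw [← h] at h'
    have h'' := ofWord_mem_wrev h'
    rwa [wrev_wrev] at h''
  · have h : ofWord n (fun l => toWord (rowVec A) (List.ofFn x ++ l)) =
        WithLp.toLp 2 (A (x ∘ Fin.rev)) := by
      ext y
      refine Eq.trans ?_ (toWord_rowVec A (x ∘ Fin.rev) y)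
      rw [reverse_ofFn, comp_rev_rev]
      rfl
    rw [h]
    exact hA.2 _

theorem rowVec_sub_smul {N m n : ℕ} (A B : Matrix (Fin m → Fin N) (Fin n → Fin N) ℂ) (c : ℂ) :
    rowVec (A - c • B) = rowVec A - c • rowVec B := rfl

theorem starProjection_rowVec_of_ne {N m n : ℕ} (h : m ≠ n)
    {A : Matrix (Fin m → Fin N) (Fin n → Fin N) ℂ} (hA : A ∈ harmonicMat N m n) :
    (fixSpace N (m + n)).starProjection (rowVec A) = 0 :=
  starProjection_fixSpace_eq_zero ((splitHarmonic_rowVec hA).mem_contrKer fun e => absurd e h)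

/-- Schur's lemma: on `H_n ⊗ H_n` the projection onto the fixed vectors depends only on the trace,
because a difference with zero trace has zero nested contraction and so is orthogonal to all fixed
vectors. -/
theorem starProjection_rowVec {N n : ℕ} {A B : Matrix (Fin n → Fin N) (Fin n → Fin N) ℂ}
    (hA : A ∈ harmonicMat N n n) (hB : B ∈ harmonicMat N n n) (htr : B.trace ≠ 0) :
    (fixSpace N (n + n)).starProjection (rowVec A) =
      (A.trace / B.trace) • (fixSpace N (n + n)).starProjection (rowVec B) := by
  rw [← sub_eq_zero, ← map_smul, ← map_sub, ← rowVec_sub_smul]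
  refine starProjection_fixSpace_eq_zero ((splitHarmonic_rowVec
    (Submodule.sub_mem _ hA (Submodule.smul_mem _ _ hB))).mem_contrKer fun _ => ?_)
  rw [nested_rowVec, Matrix.trace_sub, Matrix.trace_smul, smul_eq_mul, div_mul_cancel₀ _ htr,
    sub_self]

/-- The nested pairing is fixed. -/
theorem rowVec_one_mem (N n : ℕ) :
    rowVec (1 : Matrix (Fin n → Fin N) (Fin n → Fin N) ℂ) ∈ fixSpace N (n + n) := by
  intro z
  obtain ⟨x, y, rfl⟩ := exists_append N n n z
  obtain ⟨x, rfl⟩ : ∃ x', x = x' ∘ Fin.rev := ⟨x ∘ Fin.rev, (comp_rev_rev x).symm⟩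
  rw [sum_rowVec]
  simp only [rowVec_append, genPow_append, Matrix.one_apply]
  -- Invariance of the nested pairing is the relation `u^{⊗n} (u^{⊗n})^* = 1`, read entry by entry.
  have h := genPow_row N n (x ∘ Fin.rev) (y ∘ Fin.rev)
  have e : (x ∘ Fin.rev = y ∘ Fin.rev) = (x = y) := by
    refine propext ⟨fun h => ?_, fun h => by rw [h]⟩
    rw [← comp_rev_rev x, h, comp_rev_rev]
  let R : (Fin n → Fin N) ≃ (Fin n → Fin N) := Equiv.arrowCongr Fin.revPerm (Equiv.refl _)
  rw [← R.sum_comp] at h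
  simp only [star_genPow, comp_rev_rev, e] at h
  have h' : ∀ z : Fin n → Fin N, R z = z ∘ Fin.rev := fun z => rfl
  simp only [h', comp_rev_rev] at h
  simpa using h

theorem extend_mem {N n : ℕ} (X : BH N n) :
    (∀ y, WithLp.toLp 2 (fun x => extend N n X x y) ∈ HSpace N n) ∧
      ∀ x, WithLp.toLp 2 (extend N n X x) ∈ HSpace N n :=
  (exists_extend_iff _).1 ⟨X, rfl⟩

/-- The product of a row of `X` and a conjugate row of `Y`. -/
def rowMat {N m n : ℕ} (X : BH N m) (Y : BH N n) (j : Fin m → Fin N) (l : Fin n → Fin N) :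
    Matrix (Fin m → Fin N) (Fin n → Fin N) ℂ :=
  Matrix.of fun i k => extend N m X j i * starRingEnd ℂ (extend N n Y l k)

theorem rowMat_mem {N m n : ℕ} (X : BH N m) (Y : BH N n) (j : Fin m → Fin N)
    (l : Fin n → Fin N) : rowMat X Y j l ∈ harmonicMat N m n := by
  refine ⟨fun k => ?_, fun i => ?_⟩
  · have h := Submodule.smul_mem _ (starRingEnd ℂ (extend N n Y l k)) ((extend_mem X).2 j)
    convert h using 1
    ext i
    exact mul_comm _ _
  · exact Submodule.smul_mem _ (extend N m X j i) (conjVec_mem ((extend_mem Y).2 l))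

/-- The Haar state of a product of coefficients is an entry of the projection onto the fixed vectors
of `u^{⊗(m+n)}`, the involution reversing the first word. Summing over `i` and `k` applies this
hermitian matrix to `rowMat X Y j l`, up to conjugation. -/
theorem haarForm_coeff {N m n : ℕ} (X : BH N m) (Y : BH N n) :
    haarForm N (star (coeff N m X) * coeff N n Y) =
      ∑ j, ∑ l, starRingEnd ℂ ((fixSpace N (m + n)).starProjection (rowVec (rowMat X Y j l))
        (Fin.append (j ∘ Fin.rev) l)) := by
  have h : ∀ j l, starRingEnd ℂ ((fixSpace N (m + n)).starProjection (rowVec (rowMat X Y j l))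
        (Fin.append (j ∘ Fin.rev) l)) = ∑ i, ∑ k, starRingEnd ℂ (extend N m X j i) *
          extend N n Y l k * haarForm N (star (genPow N m i j) * genPow N n k l) := by
    intro j l
    rw [starProjection_apply', sum_rowVec, map_sum]
    refine Finset.sum_congr rfl fun i _ => ?_
    rw [map_sum]
    refine Finset.sum_congr rfl fun k _ => ?_
    rw [map_mul, conj_fixMat, haarForm_star_mul, rowVec_append, rowMat, Matrix.of_apply, map_mul,
      Complex.conj_conj]
    ring
  simp only [h]
  change haarForm N (star (∑ i, ∑ j, extend N m X j i • genPow N m i j) *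
    ∑ k, ∑ l, extend N n Y l k • genPow N n k l) = _
  simp only [star_sum, star_smul, Finset.sum_mul, Finset.mul_sum, smul_mul_assoc, mul_smul_comm,
    map_sum, map_smul, smul_eq_mul]
  have hc : ∀ f : (Fin m → Fin N) → (Fin n → Fin N) → (Fin m → Fin N) → (Fin n → Fin N) → ℂ,
      ∑ k, ∑ l, ∑ i, ∑ j, f j l i k = ∑ j, ∑ l, ∑ i, ∑ k, f j l i k := by
    intro f
    calc _ = ∑ k, ∑ l, ∑ j, ∑ i, f j l i k :=
          Finset.sum_congr rfl fun k _ => Finset.sum_congr rfl fun l _ => Finset.sum_comm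
      _ = ∑ k, ∑ j, ∑ l, ∑ i, f j l i k := Finset.sum_congr rfl fun k _ => Finset.sum_comm
      _ = ∑ j, ∑ k, ∑ l, ∑ i, f j l i k := Finset.sum_comm
      _ = ∑ j, ∑ l, ∑ k, ∑ i, f j l i k := Finset.sum_congr rfl fun j _ => Finset.sum_comm
      _ = _ := Finset.sum_congr rfl fun j _ => Finset.sum_congr rfl fun l _ => Finset.sum_comm
  rw [← hc]
  refine Finset.sum_congr rfl fun k _ => Finset.sum_congr rfl fun l _ =>
    Finset.sum_congr rfl fun i _ => Finset.sum_congr rfl fun j _ => ?_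
  rw [Complex.star_def]
  ring

/-- Coefficients of `u_m` and `u_n` are orthogonal for `m ≠ n`. -/
theorem haarForm_coeff_of_ne {N m n : ℕ} (h : m ≠ n) (X : BH N m) (Y : BH N n) :
    haarForm N (star (coeff N m X) * coeff N n Y) = 0 := by
  rw [haarForm_coeff]
  refine Finset.sum_eq_zero fun j _ => Finset.sum_eq_zero fun l _ => ?_
  rw [starProjection_rowVec_of_ne h (rowMat_mem X Y j l)]
  simp

/-- The Haar state is faithful on the coefficients of `u_n`. -/
theorem eq_zero_of_haarForm_coeff {N n : ℕ} {X : BH N n}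
    (h : haarForm N (star (coeff N n X) * coeff N n X) = 0) : X = 0 := by
  -- The Gram matrix of the rows of `X`. Its trace is the squared Hilbert–Schmidt norm of `X`, and
  -- its entries are the conjugate traces of the matrices `rowMat X X j l`. It is harmonic itself,
  -- so it can serve as the reference matrix in `starProjection_rowVec`.
  let C : Matrix (Fin n → Fin N) (Fin n → Fin N) ℂ :=
    Matrix.of fun j l => ∑ i, starRingEnd ℂ (extend N n X j i) * extend N n X l i
  have hC : C ∈ harmonicMat N n n := by
    refine ⟨fun l => ?_, fun j => ?_⟩
    · have e : WithLp.toLp 2 (fun j => C j l) = ∑ i, extend N n X l i •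
          conjVec (WithLp.toLp 2 fun j => extend N n X j i) := by
        ext j
        simp [C, conjVec, mul_comm]
      rw [e]
      exact Submodule.sum_mem _ fun i _ =>
        Submodule.smul_mem _ _ (conjVec_mem ((extend_mem X).1 i))
    · have e : WithLp.toLp 2 (C j) = ∑ i, starRingEnd ℂ (extend N n X j i) •
          WithLp.toLp 2 fun l => extend N n X l i := by
        ext l
        simp [C]
      rw [e]
      exact Submodule.sum_mem _ fun i _ => Submodule.smul_mem _ _ ((extend_mem X).1 i)
  have htr : C.trace = ((∑ j, ∑ i, Complex.normSq (extend N n X j i) : ℝ) : ℂ) := by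
    simp only [Matrix.trace, Matrix.diag, C, Matrix.of_apply, ← Complex.normSq_eq_conj_mul_self]
    push_cast
    rfl
  have hzero : C.trace = 0 → X = 0 := by
    intro h0
    rw [htr, Complex.ofReal_eq_zero] at h0
    refine extend_injective N n ?_
    ext j i
    have h1 := (Finset.sum_eq_zero_iff_of_nonneg fun j _ => Finset.sum_nonneg fun i _ =>
      Complex.normSq_nonneg (extend N n X j i)).1 h0 j (Finset.mem_univ j)
    have h2 := (Finset.sum_eq_zero_iff_of_nonneg fun i _ =>
      Complex.normSq_nonneg (extend N n X j i)).1 h1 i (Finset.mem_univ i)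
    rw [map_zero]
    exact Complex.normSq_eq_zero.1 h2
  by_contra hX
  have hs : C.trace ≠ 0 := fun h0 => hX (hzero h0)
  let ζ : TPow N (n + n) := rowVec C
  let F := (fixSpace N (n + n)).starProjection
  have hrow : ∀ j l, F (rowVec (rowMat X X j l)) = (starRingEnd ℂ (C j l) / C.trace) • F ζ := by
    intro j l
    have e : (rowMat X X j l).trace = starRingEnd ℂ (C j l) := by
      simp [C, rowMat, Matrix.trace, map_sum]
    rw [← e]
    exact starProjection_rowVec (rowMat_mem X X j l) hC hs
  -- Since each projection is a multiple of `F ζ` with a coefficient read off from `C`, the double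
  -- sum for `h(u_n(X)^* u_n(X))` is the scalar product of `F ζ` with `ζ`, divided by the trace. As
  -- `F` is a projection, `F ζ = 0` follows.
  have hinner : inner ℂ (F ζ) ζ = 0 := by
    have h1 : haarForm N (star (coeff N n X) * coeff N n X) =
        (starRingEnd ℂ C.trace)⁻¹ * inner ℂ (F ζ) ζ := by
      rw [haarForm_coeff, PiLp.inner_apply, sum_rowVec, Finset.mul_sum]
      refine Finset.sum_congr rfl fun j _ => ?_
      rw [Finset.mul_sum]
      refine Finset.sum_congr rfl fun l _ => ?_
      have h2 := hrow j l
      simp only [F] at h2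
      rw [h2]
      simp only [ζ, F, rowVec_append, PiLp.smul_apply, smul_eq_mul, map_mul, map_div₀,
        Complex.conj_conj, RCLike.inner_apply]
      ring
    rw [h] at h1
    exact (mul_eq_zero.1 h1.symm).resolve_left (inv_ne_zero ((map_ne_zero _).2 hs))
  have hF : F ζ = 0 := by
    have h1 : inner ℂ (F ζ) (F ζ) = 0 := by
      rw [← hinner, ← (fixSpace N (n + n)).inner_starProjection_left_eq_right,
        Submodule.starProjection_eq_self_iff.2 (Submodule.starProjection_apply_mem _ _)]
    exact inner_self_eq_zero.1 h1
  -- The nested pairing is fixed by `F`, so its scalar product with `ζ`, which is the trace of `C`,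
  -- would vanish.
  refine hs ?_
  have h1 : inner ℂ (rowVec (1 : Matrix (Fin n → Fin N) (Fin n → Fin N) ℂ)) ζ = C.trace := by
    rw [PiLp.inner_apply, sum_rowVec]
    simp only [ζ, rowVec_append, RCLike.inner_apply, Matrix.one_apply]
    simp [Matrix.trace]
  rw [← h1, ← Submodule.starProjection_eq_self_iff.2 (rowVec_one_mem N n),
    (fixSpace N (n + n)).inner_starProjection_left_eq_right]
  exact (congrArg _ hF).trans (inner_zero_right _)

/-! ### The subspaces `p_n H^{∘∘}` -/

theorem coeffL2_injective (N n : ℕ) : Function.Injective (coeffL2 (haar N) n) := by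
  rw [← LinearMap.ker_eq_bot, LinearMap.ker_eq_bot']
  intro X hX
  refine eq_zero_of_haarForm_coeff ?_
  have h := inner_toL2 (haar N) (coeff N n X) (coeff N n X)
  have hX' : toL2 (haar N) (coeff N n X) = 0 := hX
  rw [hX', inner_zero_left] at h
  exact h.symm

theorem proj_coeffL2_self {N : ℕ} (n : ℕ) (X : BH N n) :
    proj (haar N) n (coeffL2 (haar N) n X) = coeffL2 (haar N) n X :=
  Submodule.starProjection_eq_self_iff.2 ⟨X, rfl⟩

theorem proj_coeffL2_of_ne {N m n : ℕ} (h : m ≠ n) (X : BH N m) :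
    proj (haar N) n (coeffL2 (haar N) m X) = 0 := by
  refine (Submodule.starProjection_apply_eq_zero_iff _).2
    ((Submodule.mem_orthogonal' _ _).2 ?_)
  rintro _ ⟨Y, rfl⟩
  exact (inner_toL2 (haar N) _ _).trans (haarForm_coeff_of_ne h X Y)

/-- The projection `p_n` fixes `u_n(B(H_n)^{∘∘})` and kills the other summands. The target is
finite-dimensional, hence closed, so passing to the closed span adds nothing to the image. -/
theorem projHCirc_eq {N n : ℕ} (hn : 1 ≤ n) :
    projHCirc (haar N) n = (BCirc N n).map (coeffL2 (haar N) n) := by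
  let W := (BCirc N n).map (coeffL2 (haar N) n)
  refine le_antisymm ?_ ?_
  · rw [projHCirc, Submodule.map_le_iff_le_comap]
    refine Submodule.topologicalClosure_minimal _ (iSup₂_le fun m _ => ?_)
      ((Submodule.closed_of_finiteDimensional W).preimage (proj (haar N) n).continuous)
    rintro _ ⟨X, hX, rfl⟩
    by_cases h : m = n
    · subst h
      exact Submodule.mem_comap.2 (by
        change proj (haar N) m (coeffL2 (haar N) m X) ∈ W
        rw [proj_coeffL2_self]
        exact ⟨X, hX, rfl⟩)
    · exact Submodule.mem_comap.2 (by
        change proj (haar N) n (coeffL2 (haar N) m X) ∈ W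
        rw [proj_coeffL2_of_ne h]
        exact W.zero_mem)
  · rintro _ ⟨X, hX, rfl⟩
    refine ⟨coeffL2 (haar N) n X, Submodule.le_topologicalClosure _ ?_, proj_coeffL2_self n X⟩
    exact Submodule.mem_iSup_of_mem n (Submodule.mem_iSup_of_mem hn ⟨X, hX, rfl⟩)

theorem finrank_projHCirc {N n : ℕ} (hn : 1 ≤ n) :
    Module.finrank ℂ (projHCirc (haar N) n) = Module.finrank ℂ (BCirc N n) := by
  rw [projHCirc_eq hn]
  exact (Submodule.equivMapOfInjective _ (coeffL2_injective N n) _).finrank_eq.symm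

end FON

end

theorem mainTheorem9 (N : ℕ) (hN : 3 ≤ N) :
    (∀ n : ℕ, 2 ≤ n →
      (Module.finrank ℂ (FON.BCirc N n) : ℤ) =
          (FON.d N (2 * n) : ℤ) - (FON.d N (2 * n - 2) : ℤ) ∧
      (Module.finrank ℂ (FON.projHCirc (FON.haar N) n) : ℤ) =
          (FON.d N (2 * n) : ℤ) - (FON.d N (2 * n - 2) : ℤ)) ∧
    Module.finrank ℂ (FON.BCirc N 1) = FON.d N 2 ∧
    Module.finrank ℂ (FON.projHCirc (FON.haar N) 1) = FON.d N 2 := by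
  rw [FON.finrank_projHCirc le_rfl, FON.finrank_BCirc_one]
  refine ⟨fun n hn => ?_, rfl, rfl⟩
  rw [FON.finrank_projHCirc (by omega), ← FON.finrank_BCirc_add hN hn]
  push_cast
  exact ⟨by ring, by ring⟩
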